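/- Let $k\ge 2$ and let $S$ be the compactified star graph with $k$ edges: the union of $k$ copies $\{i\}\times[0,\infty]$, $i=1,\dots,k$, of the compactified half-line with all left ends $(i,0)$ identified to one point $\mathfrak 0$ (the center). Let $C(S)$ be the space of real continuous functions on $S$ with the supremum norm; for $f\in C(S)$ write $f_i(x)=f(i,x)$, and for $x\in S$ let $|x|\in[0,\infty]$ be its distance from $\mathfrak 0$. Let $C^2(S)$ be the space of $f\in C(S)$ such that each $f_i$ is twice continuously differentiable on $[0,\infty)$ (one-sided derivatives at $0$), each $f_i''$ has a finite limit at $\infty$, and $f_i''(0)=f_j''(0)$ for all $i,j$; let $f''\in C(S)$ be the function with coordinates $f_i''$, and let $\Delta f=\tfrac12 f''$. A Feller semigroup on $C(S)$ is a strongly continuous semigroup of positive contractions of $C(S)$ (not necessarily conservative); a Feller generator is the generator of such a semigroup, and the semigroup generated by $G$ is denoted $\mathrm e^{tG}$. For $\alpha,\gamma\ge0$, a vector $\beta=(\beta_1,\dots,\beta_k)$ with $\beta_i\ge0$, and a Borel measure $m$ on $S$ with $m(\{\mathfrak 0\})=0$, $m(\{(i,\infty)\})=0$ for all $i$, and $\int_S(1\wedge|x|)\,m(\mathrm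 dx)<\infty$, let $G_{\alpha,\beta,\gamma,m}$ be the restriction of $\Delta$ to the set of $f\in C^2(S)$ such that $$\tfrac{\alpha}{2}f''(\mathfrak 0)-\sum_{i=1}^k\beta_i f_i'(0)+\gamma f(\mathfrak 0)=\int_S[f(x)-f(\mathfrak 0)]\,m(\mathrm dx)$$ (the integral exists for each $f\in C^2(S)$). For $\lambda>0$ and $g\in C(S)$ let $$(R^0_\lambda g)_i(x)=\frac1{\sqrt{2\lambda}}\int_0^\infty\bigl(\mathrm e^{-\sqrt{2\lambda}|x-y|}-\mathrm e^{-\sqrt{2\lambda}(x+y)}\bigr)g_i(y)\,\mathrm dy,\qquad (\ell^0_\lambda)_i(x)=\mathrm e^{-\sqrt{2\lambda}x}\qquad(0\le x<\infty),$$ extended to $x=\infty$ by their limits $g_i(\infty)/\lambda$ and $0$ ($R^0_\lambda$ is the resolvent of the minimal Brownian motion on $S$), and let $$C_i(g)=\frac1{\sqrt{2\lambda}}\int_0^\infty\mathrm e^{-\sqrt{2\lambda}y}g_i(y)\,\mathrm dy,\qquad C(g)=2\sqrt{2\lambda}\sum_{i=1}^k\beta_iC_i(g)+\alpha g(\mathfrak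 0),$$ $$\overline C(g)=\frac{\int_S R^0_\lambda g\,\mathrm dm+C(g)}{\gamma+\lambda\int_S R^0_\lambda 1\,\mathrm dm+\lambda C(1)} .$$ **Theorem.** Let $\alpha,\beta,\gamma,m$ be as above and suppose that $m(S)=\infty$. 1. $G_{\alpha,\beta,\gamma,m}$ is a Feller generator. 2. For all $\lambda>0$ and $g\in C(S)$, $R^0_\lambda g$ is $m$-integrable, the denominator of $\overline C(g)$ is positive, and $$(\lambda-G_{\alpha,\beta,\gamma,m})^{-1}g=R^0_\lambda g+\overline C(g)\,\ell^0_\lambda .$$ 3. Let $\beta(\varepsilon)=(\beta_1(\varepsilon),\dots,\beta_k(\varepsilon))$, $\varepsilon>0$, be vectors with $\beta_i(\varepsilon)>0$ for all $i$ and $\varepsilon$, and $\lim_{\varepsilon\to0+}\beta_i(\varepsilon)=\beta_i$ for all $i$. Let $m_\varepsilon$ be the restriction of $m$ to $\{x\in S:|x|\ge\varepsilon\}$ (a finite measure), and let $G_\varepsilon=G_{\alpha,\beta(\varepsilon),\gamma,m_\varepsilon}$. Then each $G_\varepsilon$, $\varepsilon>0$, is a Feller generator, and for each $f\in C(S)$,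 $\lim_{\varepsilon\to0+}\mathrm e^{tG_\varepsilon}f=\mathrm e^{tG_{\alpha,\beta,\gamma,m}}f$ in $C(S)$, uniformly for $t$ in compact subintervals of $[0,\infty)$. -/

import Mathlib

open Set Filter Topology MeasureTheory
open scoped ENNReal NNReal

noncomputable section

/-! ## Feller semigroups, their generators and resolvents -/

section Feller

variable {S : Type*} [TopologicalSpace S] [CompactSpace S]

/-- A Feller semigroup on `C(S)`: a strongly continuous semigroup of positive contractions
(not necessarily conservative). -/
structure IsFellerSemigroup (T : ℝ≥0 → C(S, ℝ) →L[ℝ] C(S, ℝ)) : Prop where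
  map_zero : T 0 = ContinuousLinearMap.id ℝ C(S, ℝ)
  map_add : ∀ s t, T (s + t) = (T s).comp (T t)
  nonneg : ∀ t f, 0 ≤ f → 0 ≤ T t f
  contraction : ∀ t, ‖T t‖ ≤ 1
  strongly_continuous : ∀ f, Continuous fun t => T t f

/-- `T` is a Feller semigroup and the (unbounded) operator `A` is its generator: `f` belongs to
the domain of `A` and `A f = g` if and only if `t⁻¹ (T t f - f) → g` in `C(S)` as `t → 0+`. -/
def Generates (A : C(S, ℝ) →ₗ.[ℝ] C(S, ℝ)) (T : ℝ≥0 → C(S, ℝ) →L[ℝ] C(S, ℝ)) : Prop :=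
  IsFellerSemigroup T ∧
    ∀ f g : C(S, ℝ), (f, g) ∈ A.graph ↔
      Tendsto (fun t : ℝ≥0 => (t : ℝ)⁻¹ • (T t f - f)) (𝓝[>] 0) (𝓝 g)

/-- `A` is the generator of some Feller semigroup. -/
def IsFellerGenerator (A : C(S, ℝ) →ₗ.[ℝ] C(S, ℝ)) : Prop :=
  ∃ T : ℝ≥0 → C(S, ℝ) →L[ℝ] C(S, ℝ), Generates A T

/-- The bounded operator `R` is the resolvent `(lam - A)⁻¹`. -/
def IsResolventAt (A : C(S, ℝ) →ₗ.[ℝ] C(S, ℝ)) (lam : ℝ) (R : C(S, ℝ) →L[ℝ] C(S, ℝ)) : Prop :=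
  (∀ g : C(S, ℝ), ∃ h : R g ∈ A.domain, lam • R g - A ⟨R g, h⟩ = g) ∧
    ∀ f : A.domain, R (lam • (f : C(S, ℝ)) - A f) = f

end Feller

/-! ## The compactified star graph -/

/-- Two points of the disjoint union of `k` copies of `[0, ∞]` are identified if they are equal
or if both are left end-points. -/
def starSetoid (k : ℕ) : Setoid (Fin k × ℝ≥0∞) where
  r p q := p = q ∨ (p.2 = 0 ∧ q.2 = 0)
  iseqv :=
    { refl := fun _ => Or.inl rfl
      symm := by
        rintro p q (h | h)
        · exact Or.inl h.symm
        · exact Or.inr h.symm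
      trans := by
        rintro p q r (rfl | h) (rfl | h')
        · exact Or.inl rfl
        · exact Or.inr h'
        · exact Or.inr h
        · exact Or.inr ⟨h.1, h'.2⟩ }

/-- The star graph with `k` edges: `k` copies of the compactified half-line `[0, ∞]`, with all
left ends identified, with the quotient topology. -/
def StarGraph (k : ℕ) : Type := Quotient (starSetoid k)

namespace StarGraph

variable {k : ℕ}

instance : TopologicalSpace (StarGraph k) := inferInstanceAs (TopologicalSpace (Quotient _))
instance : CompactSpace (StarGraph k) := inferInstanceAs (CompactSpace (Quotient _))
instance : MeasurableSpace (StarGraph k) := borel _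
instance : BorelSpace (StarGraph k) := ⟨rfl⟩

/-- The point `(i, x)`. -/
def edge (i : Fin k) (x : ℝ≥0∞) : StarGraph k := Quotient.mk (starSetoid k) (i, x)

/-- The graph's center. -/
def center [NeZero k] : StarGraph k := edge 0 0

/-- The distance `x` of the point `(i, x)` from the center. -/
def radius : StarGraph k → ℝ≥0∞ :=
  Quotient.lift Prod.snd (by
    rintro p q (rfl | h)
    · rfl
    · exact h.1.trans h.2.symm)

theorem continuous_edge (i : Fin k) : Continuous (edge i) :=
  continuous_quotient_mk'.comp (by fun_prop : Continuous fun x : ℝ≥0∞ => (i, x))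

theorem edge_zero [NeZero k] (i : Fin k) : edge i 0 = center :=
  Quotient.sound (Or.inr ⟨rfl, rfl⟩)

/-- The `i`th coordinate `f_i` of `f`, as a function on `[0, ∞)`
(extended by a constant to the negative half-line). -/
def arm (f : C(StarGraph k, ℝ)) (i : Fin k) (x : ℝ) : ℝ := f (edge i (ENNReal.ofReal x))

theorem arm_add (f g : C(StarGraph k, ℝ)) (i : Fin k) : arm (f + g) i = arm f i + arm g i := rfl

theorem arm_smul (c : ℝ) (f : C(StarGraph k, ℝ)) (i : Fin k) : arm (c • f) i = c • arm f i := rfl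

theorem arm_zero [NeZero k] (f : C(StarGraph k, ℝ)) (i : Fin k) : arm f i 0 = f center := by
  rw [arm, ENNReal.ofReal_zero, edge_zero]

/-- A continuous function on the graph is determined by its values at finite points. -/
theorem ext_arm {f g : C(StarGraph k, ℝ)} (h : ∀ i, ∀ x, 0 ≤ x → arm f i x = arm g i x) :
    f = g := by
  ext p
  obtain ⟨⟨i, x⟩, rfl⟩ := Quotient.exists_rep p
  have hd : Dense ({∞}ᶜ : Set ℝ≥0∞) := dense_compl_singleton ∞
  have := Continuous.ext_on hd (f.continuous.comp (continuous_edge i))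
    (g.continuous.comp (continuous_edge i)) (by
      intro y hy
      have := h i y.toReal ENNReal.toReal_nonneg
      simpa [arm, ENNReal.ofReal_toReal hy] using this)
  exact congrFun this x

/-! ## The Laplace operator -/

/-- Each `f_i` is twice continuously differentiable on `[0, ∞)` (with one-sided derivatives at
`0`) and `f_i'' = h_i`. As `h` is continuous on the compactified graph, this says that `f_i''`
has a finite limit at infinity and that `f_i''(0)` does not depend on `i`. -/
def IsSecondDeriv (f h : C(StarGraph k, ℝ)) : Prop :=
  ∀ i, ContDiffOn ℝ 2 (arm f i) (Ici 0) ∧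
    ∀ x, 0 ≤ x → iteratedDerivWithin 2 (arm f i) (Ici 0) x = arm h i x

theorem IsSecondDeriv.unique {f h h' : C(StarGraph k, ℝ)} (H : IsSecondDeriv f h)
    (H' : IsSecondDeriv f h') : h = h' :=
  ext_arm fun i x hx => ((H i).2 x hx).symm.trans ((H' i).2 x hx)

theorem IsSecondDeriv.add {f g h l : C(StarGraph k, ℝ)} (H : IsSecondDeriv f h)
    (H' : IsSecondDeriv g l) : IsSecondDeriv (f + g) (h + l) := by
  intro i
  refine ⟨(H i).1.add (H' i).1, fun x hx => ?_⟩
  rw [arm_add, arm_add, iteratedDerivWithin_add (mem_Ici.2 hx) (uniqueDiffOn_Ici 0) ((H i).1 x hx)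
    ((H' i).1 x hx), (H i).2 x hx, (H' i).2 x hx, Pi.add_apply]

theorem IsSecondDeriv.smul {f h : C(StarGraph k, ℝ)} (c : ℝ) (H : IsSecondDeriv f h) :
    IsSecondDeriv (c • f) (c • h) := by
  intro i
  refine ⟨(H i).1.const_smul c, fun x hx => ?_⟩
  rw [arm_smul, arm_smul, iteratedDerivWithin_const_smul (mem_Ici.2 hx) (uniqueDiffOn_Ici 0) c
    ((H i).1 x hx), (H i).2 x hx, Pi.smul_apply]

theorem IsSecondDeriv.zero : IsSecondDeriv (0 : C(StarGraph k, ℝ)) 0 := by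
  intro i
  have h0 : arm (0 : C(StarGraph k, ℝ)) i = fun _ => 0 := rfl
  refine ⟨by rw [h0]; exact contDiffOn_const, fun x _ => ?_⟩
  rw [h0, iteratedDerivWithin_const]
  simp

/-- The space `C²(S)`. -/
def C2 (k : ℕ) : Submodule ℝ C(StarGraph k, ℝ) where
  carrier := {f | ∃ h, IsSecondDeriv f h}
  add_mem' := fun ⟨_, h⟩ ⟨_, h'⟩ => ⟨_, h.add h'⟩
  zero_mem' := ⟨0, IsSecondDeriv.zero⟩
  smul_mem' := fun c _ ⟨_, h⟩ => ⟨_, h.smul c⟩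

/-- The second derivative `f''` of `f ∈ C²(S)`, an element of `C(S)`. -/
def secondDeriv (k : ℕ) : C2 k →ₗ[ℝ] C(StarGraph k, ℝ) where
  toFun f := f.2.choose
  map_add' f g := (f + g).2.choose_spec.unique (f.2.choose_spec.add g.2.choose_spec)
  map_smul' c f := (c • f).2.choose_spec.unique (f.2.choose_spec.smul c)

/-- The Laplace operator `Δ f = f'' / 2` with domain `C²(S)`. -/
def laplacian (k : ℕ) : C(StarGraph k, ℝ) →ₗ.[ℝ] C(StarGraph k, ℝ) where
  domain := C2 k
  toFun := (1 / 2 : ℝ) • secondDeriv k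

/-- The one-sided derivative `f_i'(0)` at the center along the `i`th edge. -/
def slope (f : C(StarGraph k, ℝ)) (i : Fin k) : ℝ := derivWithin (arm f i) (Ici 0) 0

/-! ## Feller–Wentzell boundary conditions -/

theorem differentiableWithinAt_arm {f : C(StarGraph k, ℝ)} (hf : f ∈ C2 k) (i : Fin k) :
    DifferentiableWithinAt ℝ (arm f i) (Ici 0) 0 := by
  obtain ⟨h, H⟩ := hf
  exact ((H i).1.differentiableOn (by norm_num)) 0 self_mem_Ici

theorem slope_add {f g : C(StarGraph k, ℝ)} (hf : f ∈ C2 k) (hg : g ∈ C2 k) (i : Fin k) :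
    slope (f + g) i = slope f i + slope g i :=
  derivWithin_add (differentiableWithinAt_arm hf i) (differentiableWithinAt_arm hg i)

theorem slope_smul {f : C(StarGraph k, ℝ)} (c : ℝ) (hf : f ∈ C2 k) (i : Fin k) :
    slope (c • f) i = c * slope f i :=
  derivWithin_const_smul c (differentiableWithinAt_arm hf i)

/-- Functions in `C²(S)` satisfy `|f(x) - f(0)| ≤ K (1 ∧ |x|)`. -/
theorem exists_bound [NeZero k] {f : C(StarGraph k, ℝ)} (hf : f ∈ C2 k) :
    ∃ K : ℝ≥0, ∀ x, ‖f x - f center‖ₑ ≤ K * min 1 (radius x) := by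
  have key : ∀ i : Fin k, ∃ K : ℝ≥0, ∀ x : ℝ≥0∞,
      ‖f (edge i x) - f center‖ₑ ≤ K * min 1 x := by
    intro i
    have hO := (differentiableWithinAt_arm hf i).isBigO_sub
    obtain ⟨c, hc, hO⟩ := hO.exists_pos
    rw [Asymptotics.IsBigOWith, eventually_nhdsWithin_iff, Metric.eventually_nhds_iff] at hO
    obtain ⟨d, hd, hO⟩ := hO
    set e : ℝ := min d 1 with he
    have he0 : 0 < e := lt_min hd one_pos
    have he1 : e ≤ 1 := min_le_right _ _
    set M : ℝ := max c (2 * ‖f‖ / e) with hM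
    have hM0 : 0 ≤ M := hc.le.trans (le_max_left _ _)
    have hMf : 2 * ‖f‖ ≤ M * e := by
      rw [← div_le_iff₀ he0]; exact le_max_right _ _
    have hb : ∀ p, ‖f p - f center‖ ≤ 2 * ‖f‖ := fun p => by
      have h1 := norm_sub_le (f p) (f center)
      have h2 := f.norm_coe_le_norm p
      have h3 := f.norm_coe_le_norm center
      linarith
    refine ⟨⟨M, hM0⟩, fun x => ?_⟩
    have hreal : ‖f (edge i x) - f center‖ ≤ M * (min 1 x).toReal := by
      by_cases hx : x = ∞
      · subst hx
        have := hb (edge i ∞)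
        simp only [le_top, inf_of_le_left, ENNReal.toReal_one, mul_one]
        nlinarith
      · have hxr : x = ENNReal.ofReal x.toReal := (ENNReal.ofReal_toReal hx).symm
        have hmin : (min 1 x).toReal = min 1 x.toReal := by
          rw [ENNReal.toReal_min ENNReal.one_ne_top hx, ENNReal.toReal_one]
        rw [hmin]
        have hx0 : 0 ≤ x.toReal := ENNReal.toReal_nonneg
        by_cases hlt : x.toReal < e
        · have h1 := hO (y := x.toReal)
            (by rw [Real.dist_eq, sub_zero, abs_of_nonneg hx0]
                exact hlt.trans_le (min_le_left _ _)) hx0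
          rw [arm_zero, arm, ← hxr, sub_zero, Real.norm_of_nonneg hx0] at h1
          rw [min_eq_right (hlt.le.trans he1)]
          exact h1.trans (mul_le_mul_of_nonneg_right (le_max_left _ _) hx0)
        · have h2 : e ≤ min 1 x.toReal := le_min he1 (not_lt.1 hlt)
          exact (hb _).trans (hMf.trans (mul_le_mul_of_nonneg_left h2 hM0))
    have hfin : min 1 x ≠ ∞ := ne_top_of_le_ne_top ENNReal.one_ne_top (min_le_left _ _)
    rw [← ofReal_norm]
    refine (ENNReal.ofReal_le_ofReal hreal).trans ?_
    rw [ENNReal.ofReal_mul hM0, ENNReal.ofReal_toReal hfin,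
      ENNReal.ofReal_eq_coe_nnreal hM0]
    exact le_rfl
  choose K hK using key
  refine ⟨∑ i, K i, fun p => ?_⟩
  obtain ⟨⟨i, x⟩, rfl⟩ := Quotient.exists_rep p
  refine (hK i x).trans (mul_le_mul_left ?_ _)
  exact ENNReal.coe_le_coe.2 (Finset.single_le_sum (fun _ _ => bot_le) (Finset.mem_univ i))

theorem integrable_sub_center [NeZero k] {m : Measure (StarGraph k)}
    (hm : ∫⁻ x, min 1 (radius x) ∂m < ∞) {f : C(StarGraph k, ℝ)} (hf : f ∈ C2 k) :
    Integrable (fun x => f x - f center) m := by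
  obtain ⟨K, hK⟩ := exists_bound hf
  refine ⟨(f.continuous.sub continuous_const).aestronglyMeasurable, ?_⟩
  refine (lintegral_mono hK).trans_lt ?_
  rw [lintegral_const_mul' _ _ ENNReal.coe_ne_top]
  exact ENNReal.mul_lt_top ENNReal.coe_lt_top hm

/-- The functions `f ∈ C²(S)` that satisfy the Feller–Wentzell boundary condition
`(α/2) f''(0) - ∑ β_i f_i'(0) + γ f(0) = ∫ [f(x) - f(0)] m(dx)`. -/
def wentzellDomain [NeZero k] (α : ℝ) (β : Fin k → ℝ) (γ : ℝ) (m : Measure (StarGraph k))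
    (hm : ∫⁻ x, min 1 (radius x) ∂m < ∞) : Submodule ℝ C(StarGraph k, ℝ) where
  carrier := {f | ∃ hf : f ∈ C2 k,
    α / 2 * secondDeriv k ⟨f, hf⟩ center - ∑ i, β i * slope f i + γ * f center
      = ∫ x, (f x - f center) ∂m}
  add_mem' := by
    rintro f g ⟨hf, Hf⟩ ⟨hg, Hg⟩
    refine ⟨(C2 k).add_mem hf hg, ?_⟩
    have h1 : secondDeriv k ⟨f + g, (C2 k).add_mem hf hg⟩
        = secondDeriv k ⟨f, hf⟩ + secondDeriv k ⟨g, hg⟩ := (secondDeriv k).map_add ⟨f, hf⟩ ⟨g, hg⟩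
    have h2 : ∫ x, ((f + g) x - (f + g) center) ∂m
        = ∫ x, (f x - f center) ∂m + ∫ x, (g x - g center) ∂m := by
      rw [← integral_add (integrable_sub_center hm hf) (integrable_sub_center hm hg)]
      congr 1
      ext x
      simp only [ContinuousMap.add_apply]
      ring
    rw [h1, h2, ← Hf, ← Hg]
    simp only [slope_add hf hg, ContinuousMap.add_apply, mul_add, Finset.sum_add_distrib]
    ring
  zero_mem' := by
    refine ⟨(C2 k).zero_mem, ?_⟩
    have h1 : secondDeriv k ⟨0, (C2 k).zero_mem⟩ = 0 := (secondDeriv k).map_zero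
    have h2 : ∀ i : Fin k, slope (0 : C(StarGraph k, ℝ)) i = 0 := fun i => by
      have := slope_smul 0 (C2 k).zero_mem i
      simpa using this
    simp [h1, h2]
  smul_mem' := by
    rintro c f ⟨hf, Hf⟩
    refine ⟨(C2 k).smul_mem c hf, ?_⟩
    have h1 : secondDeriv k ⟨c • f, (C2 k).smul_mem c hf⟩ = c • secondDeriv k ⟨f, hf⟩ :=
      (secondDeriv k).map_smul c ⟨f, hf⟩
    have h2 : ∫ x, ((c • f) x - (c • f) center) ∂m = c * ∫ x, (f x - f center) ∂m := by
      rw [← integral_const_mul]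
      congr 1
      ext x
      simp only [ContinuousMap.smul_apply, smul_eq_mul]
      ring
    rw [h1, h2, ← Hf]
    have h3 : ∑ i, β i * slope (c • f) i = c * ∑ i, β i * slope f i := by
      rw [Finset.mul_sum]
      exact Finset.sum_congr rfl fun i _ => by rw [slope_smul c hf]; ring
    rw [h3]
    simp only [ContinuousMap.smul_apply, smul_eq_mul]
    ring

/-- The restriction of the Laplace operator to the functions that satisfy the Feller–Wentzell
boundary condition with parameters `α, β, γ, m`. -/
def wentzellLaplacian [NeZero k] (α : ℝ) (β : Fin k → ℝ) (γ : ℝ) (m : Measure (StarGraph k))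
    (hm : ∫⁻ x, min 1 (radius x) ∂m < ∞) : C(StarGraph k, ℝ) →ₗ.[ℝ] C(StarGraph k, ℝ) :=
  (laplacian k).domRestrict (wentzellDomain α β γ m hm)

/-- The points that lie at a distance at least `ε` from the center. -/
def outer (k : ℕ) (ε : ℝ) : Set (StarGraph k) := {x | ENNReal.ofReal ε ≤ radius x}

theorem lintegral_restrict_outer_lt_top {m : Measure (StarGraph k)}
    (hm : ∫⁻ x, min 1 (radius x) ∂m < ∞) (ε : ℝ) :
    ∫⁻ x, min 1 (radius x) ∂(m.restrict (outer k ε)) < ∞ :=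
  (lintegral_mono' Measure.restrict_le_self le_rfl).trans_lt hm

/-! ## The resolvent of the minimal Brownian motion -/

/-- The resolvent of the minimal Brownian motion at a finite point `x` of the `i`th edge. -/
def minimalResolventArm (lam : ℝ) (g : C(StarGraph k, ℝ)) (i : Fin k) (x : ℝ) : ℝ :=
  1 / √(2 * lam) * ∫ y in Ioi (0 : ℝ),
    (Real.exp (-√(2 * lam) * |x - y|) - Real.exp (-√(2 * lam) * (x + y))) * arm g i y

theorem minimalResolventArm_zero (lam : ℝ) (g : C(StarGraph k, ℝ)) (i : Fin k) :
    minimalResolventArm lam g i 0 = 0 := by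
  have h : ∫ y in Ioi (0 : ℝ), (Real.exp (-√(2 * lam) * |0 - y|)
      - Real.exp (-√(2 * lam) * (0 + y))) * arm g i y = ∫ _ in Ioi (0 : ℝ), (0 : ℝ) := by
    refine setIntegral_congr_fun measurableSet_Ioi fun y hy => ?_
    simp only [zero_sub, abs_neg, zero_add, abs_of_pos (mem_Ioi.1 hy), sub_self, zero_mul]
  rw [minimalResolventArm, h, integral_zero, mul_zero]

/-- The function `R⁰_lam g`; its value at the end-point `(i, ∞)` is its limit along the `i`th
edge, that is, `g(i, ∞) / lam`. -/
def minimalResolvent (lam : ℝ) (g : C(StarGraph k, ℝ)) : StarGraph k → ℝ :=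
  Quotient.lift
    (fun p : Fin k × ℝ≥0∞ =>
      if p.2 = ∞ then g (edge p.1 ∞) / lam else minimalResolventArm lam g p.1 p.2.toReal)
    (by
      rintro p q (rfl | h)
      · rfl
      · simp [h.1, h.2, minimalResolventArm_zero])

/-- The function `l⁰_lam (i, x) = exp (-√(2 lam) x)`, with value `0` at infinity. -/
def minimalLifetime (lam : ℝ) (p : StarGraph k) : ℝ :=
  if radius p = ∞ then 0 else Real.exp (-√(2 * lam) * (radius p).toReal)

/-- `C_i(g) = (2 lam)^(-1/2) ∫_0^∞ exp (-√(2 lam) y) g_i(y) dy`. -/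
def edgeCoeff (lam : ℝ) (g : C(StarGraph k, ℝ)) (i : Fin k) : ℝ :=
  1 / √(2 * lam) * ∫ y in Ioi (0 : ℝ), Real.exp (-√(2 * lam) * y) * arm g i y

/-- `C(g) = 2 √(2 lam) ∑ β_i C_i(g) + α g(0)`. -/
def coeff [NeZero k] (α : ℝ) (β : Fin k → ℝ) (lam : ℝ) (g : C(StarGraph k, ℝ)) : ℝ :=
  2 * √(2 * lam) * ∑ i, β i * edgeCoeff lam g i + α * g center

/-- The denominator of `C̄(g)`: `γ + lam ∫ R⁰_lam 1 dm + lam C(1)`. -/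
def coeffBarDenom [NeZero k] (α : ℝ) (β : Fin k → ℝ) (γ : ℝ) (m : Measure (StarGraph k))
    (lam : ℝ) : ℝ :=
  γ + lam * ∫ x, minimalResolvent lam 1 x ∂m + lam * coeff α β lam 1

/-- `C̄(g) = (∫ R⁰_lam g dm + C(g)) / (γ + lam ∫ R⁰_lam 1 dm + lam C(1))`. -/
def coeffBar [NeZero k] (α : ℝ) (β : Fin k → ℝ) (γ : ℝ) (m : Measure (StarGraph k))
    (lam : ℝ) (g : C(StarGraph k, ℝ)) : ℝ :=
  (∫ x, minimalResolvent lam g x ∂m + coeff α β lam g) / coeffBarDenom α β γ m lam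

end StarGraph

end

noncomputable section

/-! ## Contraction semigroups and resolvents -/

section Contraction

variable {X : Type*} [NormedAddCommGroup X] [NormedSpace ℝ X]

/-! On each edge the equation `lam f - f''/2 = g` has a bounded solution that is unique up to a
multiple of `exp (-√(2 lam) x)`; continuity at the center leaves one free constant, `f = R⁰ g + c
ℓ⁰`. Let `B f = ∫ (f - f(0)) dm - (α/2) f''(0) + ∑ β_i f_i'(0) - γ f(0)`. The boundary condition is
`B f = 0`, the numerator of `C̄(g)` is `B (R⁰ g)` and its denominator `D(lam)` is `-B ℓ⁰`, so the
condition says `c = C̄(g)` as soon as `D(lam) ≠ 0` (`add_smul_lifetimeMap_mem_graph_iff`,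
`mem_graph_resolvent`, `eq_zero_of_mem_graph`).

The estimates rest on `R⁰ 1 = (1 - ℓ⁰) / lam` (`minimalResolvent_one`). It yields `|R⁰ g| ≤ ‖g‖ (1 -
ℓ⁰) / lam` and `|C̄(g)| ≤ ‖g‖ / lam`; the weights `1 - ℓ⁰` and `ℓ⁰` add up to one, so `lam` times
the resolvent is a contraction. Positivity is visible in the formula. It also yields `D(lam) = γ + ∫
(1 - ℓ⁰) dm + √(2 lam) ∑ β_i + lam α`.

The assumption `m(S) = ∞` serves twice: `D(lam) > 0` because `1 - ℓ⁰ > 0` off the center, and `D` is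
unbounded because `∫ (1 - ℓ⁰) dm` increases to `m(S)`. Unboundedness makes the domain dense: `C²(S)`
is dense by Stone–Weierstrass, and `f ∈ C²(S)` enters the domain after the addition of `(B f /
D(lam)) ℓ⁰`, which is small in norm. Hille–Yosida (`exists_semigroup`) then provides the semigroup,
and the Yosida approximations keep it positive.

For the truncated measures the strictly positive `β_i(ε)` take over the role of `m(S) = ∞`, through
the term `√(2 lam) ∑ β_i(ε)`. The resolvents of `G_ε` and of the limit operator differ by a scalar
multiple of `ℓ⁰`; the scalar tends to zero by dominated convergence, and Trotter–Kato
(`tendstoUniformlyOn_semigroup`) carries this over to the semigroups. -/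

theorem ContinuousLinearMap.apply_le_of_norm_le_one {U : X →L[ℝ] X} (hU : ‖U‖ ≤ 1) (f : X) :
    ‖U f‖ ≤ ‖f‖ := by
  simpa using U.le_of_opNorm_le hU f

/-- Strong convergence of contractions extends from a dense set, uniformly in a parameter. -/
theorem tendstoUniformlyOn_apply_of_dense {ι τ : Type*} {l : Filter ι} {U : ι → τ → X →L[ℝ] X}
    {V : τ → X →L[ℝ] X} {K : Set τ} (hU : ∀ᶠ i in l, ∀ t, ‖U i t‖ ≤ 1) (hV : ∀ t, ‖V t‖ ≤ 1)
    {D : Set X} (hD : Dense D)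
    (h : ∀ f ∈ D, TendstoUniformlyOn (fun i t => U i t f) (fun t => V t f) l K) (f : X) :
    TendstoUniformlyOn (fun i t => U i t f) (fun t => V t f) l K := by
  rw [Metric.tendstoUniformlyOn_iff]
  intro ε hε
  obtain ⟨f', hf', hff'⟩ := Metric.dense_iff.1 hD f (ε / 3) (by positivity)
  rw [Metric.mem_ball, dist_eq_norm] at hf'
  filter_upwards [hU, Metric.tendstoUniformlyOn_iff.1 (h f' hff') (ε / 3) (by positivity)]
    with i hi h3 t ht
  have h3 := h3 t ht
  rw [dist_eq_norm] at h3 ⊢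
  have h1 := ContinuousLinearMap.apply_le_of_norm_le_one (hi t) (f' - f)
  have h2 := ContinuousLinearMap.apply_le_of_norm_le_one (hV t) (f' - f)
  have e : V t f - U i t f = (V t f' - U i t f') - V t (f' - f) + U i t (f' - f) := by
    simp only [map_sub]; abel
  rw [e]
  have h4 := norm_add_le ((V t f' - U i t f') - V t (f' - f)) (U i t (f' - f))
  have h5 := norm_sub_le (V t f' - U i t f') (V t (f' - f))
  linarith

theorem tendsto_apply_of_dense {ι : Type*} {l : Filter ι} {U : ι → X →L[ℝ] X}
    {V : X →L[ℝ] X} (hU : ∀ᶠ i in l, ‖U i‖ ≤ 1) (hV : ‖V‖ ≤ 1)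
    {D : Set X} (hD : Dense D)
    (h : ∀ f ∈ D, Tendsto (fun i => U i f) l (𝓝 (V f))) (f : X) :
    Tendsto (fun i => U i f) l (𝓝 (V f)) := by
  have := tendstoUniformlyOn_apply_of_dense (τ := Unit) (K := univ) (U := fun i _ => U i)
    (V := fun _ => V) (by simpa using hU) (by simpa using hV) hD (fun f hf => by
      rw [Metric.tendstoUniformlyOn_iff]
      intro ε hε
      filter_upwards [Metric.tendsto_nhds.1 (h f hf) ε hε] with i hi t _
      rwa [dist_comm]) f
  exact this.tendsto_at (mem_univ ())

/-- Product rule for a strongly continuous family of contractions. -/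
theorem hasDerivWithinAt_clm_apply_of_strong {U : ℝ → X →L[ℝ] X} {y : ℝ → X} {y' v : X} {s : ℝ}
    {I : Set ℝ} (hU : ∀ᶠ r in 𝓝[I] s, ‖U r‖ ≤ 1)
    (hc : Tendsto (fun r => U r y') (𝓝[I] s) (𝓝 (U s y')))
    (hv : HasDerivWithinAt (fun r => U r (y s)) v I s) (hy : HasDerivWithinAt y y' I s) :
    HasDerivWithinAt (fun r => U r (y r)) (v + U s y') I s := by
  rw [hasDerivWithinAt_iff_isLittleO] at *
  have h2 : (fun r => U r (y r - y s - (r - s) • y')) =o[𝓝[I] s] fun r => r - s := by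
    refine Asymptotics.IsBigO.trans_isLittleO (.of_bound 1 ?_) hy
    filter_upwards [hU] with r hr
    rw [one_mul]
    exact ContinuousLinearMap.apply_le_of_norm_le_one hr _
  have h3 : (fun r => (r - s) • (U r y' - U s y')) =o[𝓝[I] s] fun r => r - s := by
    have h0 : (fun r => U r y' - U s y') =o[𝓝[I] s] fun _ => (1 : ℝ) := by
      rw [Asymptotics.isLittleO_one_iff]
      simpa using hc.sub_const (U s y')
    simpa using (Asymptotics.isBigO_refl (fun r : ℝ => r - s) _).smul_isLittleO h0
  refine ((hv.add h2).add h3).congr_left fun r => ?_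
  simp only [map_sub, map_smul, smul_sub, smul_add]
  abel

variable [CompleteSpace X]

open NormedSpace in
-- The identity commutes with `K`. Both the norm bound and the positivity of the Yosida semigroups
-- are read off the power series of `exp (s • K)` through this factorization.
theorem exp_smul_sub_one (K : X →L[ℝ] X) (s : ℝ) :
    exp (s • (K - 1)) = Real.exp (-s) • exp (s • K) := by
  let +nondep : NormedAlgebra ℚ (X →L[ℝ] X) := .restrictScalars ℚ ℝ _
  have h1 : s • (K - 1) = algebraMap ℝ (X →L[ℝ] X) (-s) + s • K := by
    rw [Algebra.algebraMap_eq_smul_one, smul_sub, neg_smul]; abel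
  rw [h1, exp_add_of_commute (Algebra.commutes _ _), ← algebraMap_exp_comm, ← Algebra.smul_def,
    Real.exp_eq_exp_ℝ]

open NormedSpace in
-- The series of `exp (s • K)` is dominated termwise by that of `e^s`, which the factor `e^{-s}`
-- cancels.
theorem norm_exp_smul_sub_one_le {K : X →L[ℝ] X} (hK : ‖K‖ ≤ 1) {s : ℝ} (hs : 0 ≤ s) :
    ‖exp (s • (K - 1))‖ ≤ 1 := by
  have h1 := exp_series_hasSum_exp' (𝕂 := ℝ) (s • K)
  have h2 := exp_series_hasSum_exp' (𝕂 := ℝ) s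
  rw [← Real.exp_eq_exp_ℝ] at h2
  have h3 : ‖exp (s • K)‖ ≤ Real.exp s := by
    refine h1.norm_le_of_bounded h2 fun n => ?_
    rw [norm_smul, smul_pow, norm_smul, Real.norm_of_nonneg (by positivity),
      Real.norm_of_nonneg (by positivity), smul_eq_mul]
    have h5 : ‖K ^ n‖ ≤ 1 := by
      induction n with
      | zero => exact ContinuousLinearMap.norm_id_le
      | succ n ih =>
        rw [pow_succ]
        exact (norm_mul_le _ _).trans (mul_le_one₀ ih (norm_nonneg _) hK)
    exact mul_le_mul_of_nonneg_left (mul_le_of_le_one_right (by positivity) h5) (by positivity)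
  rw [exp_smul_sub_one, norm_smul, Real.norm_of_nonneg (Real.exp_pos _).le]
  calc _ ≤ Real.exp (-s) * Real.exp s := by gcongr
    _ = 1 := by rw [← Real.exp_add]; simp

open NormedSpace in
theorem hasDerivAt_exp_smul_apply (Y : X →L[ℝ] X) (f : X) (t : ℝ) :
    HasDerivAt (fun u : ℝ => exp (u • Y) f) (exp (t • Y) (Y f)) t := by
  have := (hasDerivAt_exp_smul_const Y t).clm_apply (hasDerivAt_const t f)
  simpa using this

open NormedSpace in
/-- Semigroups with commuting generators differ at most by the difference of these. -/
theorem norm_exp_smul_sub_exp_smul_le {Y Z : X →L[ℝ] X} (h : Commute Y Z)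
    (hY : ∀ t : ℝ, 0 ≤ t → ‖exp (t • Y)‖ ≤ 1) (hZ : ∀ t : ℝ, 0 ≤ t → ‖exp (t • Z)‖ ≤ 1)
    {t : ℝ} (ht : 0 ≤ t) (f : X) :
    ‖exp (t • Y) f - exp (t • Z) f‖ ≤ t * ‖Y f - Z f‖ := by
  -- Interpolation between the two semigroups: the path runs from `exp (t • Z) f` to `exp (t • Y)
  -- f`, and by commutation its velocity is a product of contractions applied to `Y f - Z f`.
  have hd : ∀ s : ℝ, HasDerivAt (fun u : ℝ => exp (u • Y) (exp ((t - u) • Z) f))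
      (exp (s • Y) (exp ((t - s) • Z) (Y f - Z f))) s := by
    intro s
    have h1 := hasDerivAt_exp_smul_const Y s
    have h2 := ((hasDerivAt_exp_smul_apply Z f (t - s)).scomp s
      ((hasDerivAt_id s).const_sub t))
    have h3 := h1.clm_apply h2
    refine h3.congr_deriv ?_
    have hc : Commute Y (exp ((t - s) • Z)) := (h.smul_right _).exp_right
    have hc' : Y (exp ((t - s) • Z) f) = exp ((t - s) • Z) (Y f) :=
      congrArg (fun L : X →L[ℝ] X => L f) hc.eq
    simp [hc', ← sub_eq_add_neg]
  have := norm_image_sub_le_of_norm_deriv_right_le_segment (a := 0) (b := t)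
    (C := ‖Y f - Z f‖) (fun s _ => (hd s).continuousAt.continuousWithinAt)
    (fun s _ => (hd s).hasDerivWithinAt) (fun s hs => by
      refine (ContinuousLinearMap.apply_le_of_norm_le_one (hY s hs.1) _).trans ?_
      exact ContinuousLinearMap.apply_le_of_norm_le_one (hZ _ (by linarith [hs.2])) _) t
      (right_mem_Icc.2 ht)
  simp only [sub_self, zero_smul, exp_zero, sub_zero, one_apply_eq_self]
    at this
  linarith

open NormedSpace in
-- Mean value inequality along an orbit. With `h = 0` it gives Lipschitz bounds, with `h` the value
-- of the generator it controls difference quotients.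
theorem norm_exp_smul_apply_sub_le {Y : X →L[ℝ] X} {s t : ℝ} (hst : s ≤ t) (f h : X) {c : ℝ}
    (hc : ∀ u ∈ Ico s t, ‖exp (u • Y) (Y f) - h‖ ≤ c) :
    ‖exp (t • Y) f - exp (s • Y) f - (t - s) • h‖ ≤ c * (t - s) := by
  have hd : ∀ u : ℝ, HasDerivAt (fun u : ℝ => exp (u • Y) f - (u - s) • h)
      (exp (u • Y) (Y f) - h) u := by
    intro u
    have := ((hasDerivAt_id u).sub_const s).smul_const h
    rw [one_smul] at this
    exact (hasDerivAt_exp_smul_apply Y f u).sub this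
  have := norm_image_sub_le_of_norm_deriv_right_le_segment (a := s) (b := t)
    (C := c) (fun s _ => (hd s).continuousAt.continuousWithinAt)
    (fun s _ => (hd s).hasDerivWithinAt) hc t (right_mem_Icc.2 hst)
  simp only [sub_self, zero_smul, sub_zero] at this
  convert this using 2
  abel

end Contraction

/-! ### The Hille–Yosida theorem -/

section HilleYosida

variable {X : Type*} [NormedAddCommGroup X] [NormedSpace ℝ X]

/-- `R` is the resolvent of the densely defined operator `A` and `‖lam R_lam‖ ≤ 1` for all
`lam > 0`. -/
structure HasContractionResolvent (A : X →ₗ.[ℝ] X) (R : ℝ → X →L[ℝ] X) : Prop where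
  mem_graph : ∀ lam, 0 < lam → ∀ g, (R lam g, lam • R lam g - g) ∈ A.graph
  left_inv : ∀ lam, 0 < lam → ∀ f h, (f, h) ∈ A.graph → R lam (lam • f - h) = f
  norm_le : ∀ lam, 0 < lam → ‖lam • R lam‖ ≤ 1
  dense : Dense {f | ∃ h, (f, h) ∈ A.graph}

/-- `T` is a strongly continuous contraction semigroup with generator `A`. -/
structure GeneratesContractions (A : X →ₗ.[ℝ] X) (T : ℝ≥0 → X →L[ℝ] X) : Prop where
  map_zero : T 0 = ContinuousLinearMap.id ℝ X
  map_add : ∀ s t, T (s + t) = (T s).comp (T t)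
  norm_le : ∀ t, ‖T t‖ ≤ 1
  continuous : ∀ f, Continuous fun t => T t f
  mem_graph_iff : ∀ f g, (f, g) ∈ A.graph ↔
    Tendsto (fun t : ℝ≥0 => (t : ℝ)⁻¹ • (T t f - f)) (𝓝[>] 0) (𝓝 g)

/-- The Yosida approximation of `A`. -/
def yosida (R : ℝ → X →L[ℝ] X) (lam : ℝ) : X →L[ℝ] X := lam • (lam • R lam - 1)

open NormedSpace in
/-- The semigroup generated by the Yosida approximation. -/
def yosidaExp (R : ℝ → X →L[ℝ] X) (lam t : ℝ) : X →L[ℝ] X := exp (t • yosida R lam)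

namespace HasContractionResolvent

variable {A : X →ₗ.[ℝ] X} {R : ℝ → X →L[ℝ] X} (H : HasContractionResolvent A R)
include H

/-- The resolvent identity, written in both orders, exhibits the two products as the same multiple
of `R lam - R mu`. -/
theorem commute {lam mu : ℝ} (hl : 0 < lam) (hm : 0 < mu) : Commute (R lam) (R mu) := by
  by_cases h : lam = mu
  · rw [h]
  have key : ∀ {a b : ℝ}, 0 < a → 0 < b → ∀ g, R a g - R b g = (b - a) • R b (R a g) := by
    intro a b ha hb g
    have h1 := H.left_inv b hb _ _ (H.mem_graph a ha g)
    have h2 : b • R a g - (a • R a g - g) = (b - a) • R a g + g := by rw [sub_smul]; abel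
    rw [h2, map_add, map_smul] at h1
    exact sub_eq_of_eq_add h1.symm
  ext g
  have h1 := key hl hm g
  have h2 := key hm hl g
  have h3 : (mu - lam) • (R lam (R mu g)) = (mu - lam) • R mu (R lam g) := by
    rw [← h1, ← neg_sub lam mu, neg_smul, ← h2, neg_sub]
  exact smul_right_injective X (sub_ne_zero.2 (Ne.symm h)) h3

theorem commute_yosida {lam mu : ℝ} (hl : 0 < lam) (hm : 0 < mu) :
    Commute (yosida R lam) (yosida R mu) := by
  have h := H.commute hl hm
  have h2 : Commute (lam • R lam) (mu • R mu) := (h.smul_left _).smul_right _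
  exact ((((h2.sub_left (.one_left _)).sub_right (.one_right _)).smul_left _).smul_right _)

theorem smul_resolvent_sub {lam : ℝ} (hl : 0 < lam) {f h : X} (hf : (f, h) ∈ A.graph) :
    lam • R lam f - f = R lam h := by
  have := H.left_inv lam hl f h hf
  rw [map_sub, map_smul] at this
  rw [← sub_sub_cancel (lam • R lam f) (R lam h), this]

theorem yosida_apply {lam : ℝ} (hl : 0 < lam) {f h : X} (hf : (f, h) ∈ A.graph) :
    yosida R lam f = lam • R lam h := by
  simp only [yosida, smul_apply, sub_apply,
    one_apply_eq_self]
  rw [H.smul_resolvent_sub hl hf]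

theorem norm_resolvent_apply_le {lam : ℝ} (hl : 0 < lam) (h : X) : ‖R lam h‖ ≤ ‖h‖ / lam := by
  have := ContinuousLinearMap.apply_le_of_norm_le_one (H.norm_le lam hl) h
  rw [smul_apply, norm_smul, Real.norm_of_nonneg hl.le] at this
  rwa [le_div_iff₀ hl, mul_comm]

/-- On the domain the difference is `R lam h`, of norm at most `‖h‖ / lam`; density and
contractivity do the rest. -/
theorem tendsto_smul_resolvent (f : X) :
    Tendsto (fun lam : ℝ => lam • R lam f) atTop (𝓝 f) := by
  refine tendsto_apply_of_dense (U := fun lam => lam • R lam) (V := .id ℝ X) ?_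
    ContinuousLinearMap.norm_id_le H.dense ?_ f
  · filter_upwards [eventually_gt_atTop 0] with lam hl using H.norm_le lam hl
  · rintro f ⟨h, hf⟩
    rw [tendsto_iff_norm_sub_tendsto_zero]
    have h0 : Tendsto (fun lam : ℝ => ‖h‖ / lam) atTop (𝓝 0) :=
      tendsto_const_nhds.div_atTop tendsto_id
    refine squeeze_zero' (.of_forall fun _ => norm_nonneg _) ?_ h0
    filter_upwards [eventually_gt_atTop 0] with lam hl
    rw [smul_apply, ContinuousLinearMap.id_apply, H.smul_resolvent_sub hl hf]
    exact H.norm_resolvent_apply_le hl h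

theorem tendsto_yosida {f h : X} (hf : (f, h) ∈ A.graph) :
    Tendsto (fun lam : ℝ => yosida R lam f) atTop (𝓝 h) := by
  refine (H.tendsto_smul_resolvent h).congr' ?_
  filter_upwards [eventually_gt_atTop 0] with lam hl
  rw [H.yosida_apply hl hf]

theorem norm_yosida_apply_le {lam : ℝ} (hl : 0 < lam) {f h : X} (hf : (f, h) ∈ A.graph) :
    ‖yosida R lam f‖ ≤ ‖h‖ := by
  rw [H.yosida_apply hl hf]
  exact ContinuousLinearMap.apply_le_of_norm_le_one (H.norm_le lam hl) h

variable [CompleteSpace X]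

theorem norm_yosidaExp_le {lam : ℝ} (hl : 0 < lam) {t : ℝ} (ht : 0 ≤ t) :
    ‖yosidaExp R lam t‖ ≤ 1 := by
  rw [yosidaExp, yosida, smul_smul]
  exact norm_exp_smul_sub_one_le (H.norm_le lam hl) (by positivity)

/-- On the domain the Yosida approximations converge, and two of their semigroups differ by at most
`t` times the difference of the approximations; hence a Cauchy family, first on the domain and then,
by contractivity, everywhere. -/
theorem exists_tendsto_yosidaExp {t : ℝ} (ht : 0 ≤ t) (f : X) :
    ∃ g, Tendsto (fun lam : ℝ => yosidaExp R lam t f) atTop (𝓝 g) := by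
  refine cauchySeq_tendsto_of_complete ?_
  rw [Metric.cauchySeq_iff]
  intro ε hε
  obtain ⟨f', hf', ⟨h, hfh⟩⟩ := Metric.dense_iff.1 H.dense f (ε / 4) (by positivity)
  rw [Metric.mem_ball, dist_eq_norm, norm_sub_rev] at hf'
  obtain ⟨N, hN⟩ := Metric.cauchySeq_iff.1 (H.tendsto_yosida hfh).cauchySeq (ε / (4 * (t + 1)))
    (by positivity)
  refine ⟨max N 1, fun a ha b hb => ?_⟩
  have ha0 : 0 < a := lt_of_lt_of_le one_pos ((le_max_right _ _).trans ha)
  have hb0 : 0 < b := lt_of_lt_of_le one_pos ((le_max_right _ _).trans hb)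
  have h1 := hN a ((le_max_left _ _).trans ha) b ((le_max_left _ _).trans hb)
  rw [dist_eq_norm] at h1 ⊢
  have h2 := norm_exp_smul_sub_exp_smul_le (H.commute_yosida ha0 hb0)
    (fun t ht => H.norm_yosidaExp_le ha0 ht) (fun t ht => H.norm_yosidaExp_le hb0 ht) ht f'
  have h3 := ContinuousLinearMap.apply_le_of_norm_le_one (H.norm_yosidaExp_le ha0 ht) (f - f')
  have h4 := ContinuousLinearMap.apply_le_of_norm_le_one (H.norm_yosidaExp_le hb0 ht) (f - f')
  have e : yosidaExp R a t f - yosidaExp R b t f = (yosidaExp R a t f' - yosidaExp R b t f')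
      + yosidaExp R a t (f - f') - yosidaExp R b t (f - f') := by
    simp only [map_sub]; abel
  rw [e]
  have h5 := norm_sub_le ((yosidaExp R a t f' - yosidaExp R b t f')
      + yosidaExp R a t (f - f')) (yosidaExp R b t (f - f'))
  have h6 := norm_add_le (yosidaExp R a t f' - yosidaExp R b t f') (yosidaExp R a t (f - f'))
  have h7 : t * ‖yosida R a f' - yosida R b f'‖ ≤ ε / 4 := by
    calc t * ‖yosida R a f' - yosida R b f'‖ ≤ (t + 1) * (ε / (4 * (t + 1))) := by
          gcongr
          linarith
      _ = ε / 4 := by field_simp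
  have h8 : ‖yosidaExp R a t f' - yosidaExp R b t f'‖ ≤ ε / 4 := h2.trans h7
  linarith

/-- **Hille–Yosida theorem**: a densely defined operator with contractive resolvent generates a
strongly continuous contraction semigroup, the limit of the semigroups generated by its Yosida
approximations. -/
theorem exists_semigroup : ∃ T : ℝ≥0 → X →L[ℝ] X, GeneratesContractions A T ∧
    ∀ (t : ℝ≥0) f, Tendsto (fun lam : ℝ => yosidaExp R lam t f) atTop (𝓝 (T t f)) := by
  choose L hL using fun (t : ℝ≥0) f => H.exists_tendsto_yosidaExp t.2 f
  have hlim : ∀ (t : ℝ≥0) f, Tendsto (fun lam : ℝ => yosidaExp R lam t f) atTop (𝓝 (L t f)) := hL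
  have hpos := eventually_gt_atTop (0 : ℝ)
  have hLn : ∀ t f, ‖L t f‖ ≤ ‖f‖ := fun t f => by
    refine le_of_tendsto (hlim t f).norm ?_
    filter_upwards [hpos] with lam hl
    exact ContinuousLinearMap.apply_le_of_norm_le_one (H.norm_yosidaExp_le hl t.2) f
  let T : ℝ≥0 → X →L[ℝ] X := fun t => LinearMap.mkContinuous
    { toFun := L t
      map_add' := fun f g => tendsto_nhds_unique (hlim t (f + g))
        (by simpa only [map_add] using (hlim t f).add (hlim t g))
      map_smul' := fun c f => tendsto_nhds_unique (hlim t (c • f))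
        (by simpa only [map_smul, RingHom.id_apply] using (hlim t f).const_smul c) } 1
    (fun f => by simpa using hLn t f)
  have hT : ∀ (t : ℝ≥0) f, Tendsto (fun lam : ℝ => yosidaExp R lam t f) atTop (𝓝 (T t f)) := hL
  have hTn : ∀ t, ‖T t‖ ≤ 1 := fun t => LinearMap.mkContinuous_norm_le _ zero_le_one _
  have hTa : ∀ t f, ‖T t f‖ ≤ ‖f‖ := hLn
  have hT0 : T 0 = ContinuousLinearMap.id ℝ X := by
    ext f
    refine tendsto_nhds_unique (hT 0 f) ?_
    simp [yosidaExp, NormedSpace.exp_zero]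
  have hTadd : ∀ s t, T (s + t) = (T s).comp (T t) := by
    intro s t
    ext f
    refine tendsto_nhds_unique (hT (s + t) f) ?_
    rw [ContinuousLinearMap.comp_apply, tendsto_iff_norm_sub_tendsto_zero]
    have h1 := tendsto_iff_norm_sub_tendsto_zero.1 (hT t f)
    have h2 := tendsto_iff_norm_sub_tendsto_zero.1 (hT s (T t f))
    refine squeeze_zero' (.of_forall fun _ => norm_nonneg _) ?_ (by simpa using h1.add h2)
    filter_upwards [hpos] with lam hl
    have e : yosidaExp R lam ((s + t : ℝ≥0) : ℝ) f
        = yosidaExp R lam s (yosidaExp R lam t f) := by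
      let +nondep : NormedAlgebra ℚ (X →L[ℝ] X) := .restrictScalars ℚ ℝ _
      rw [yosidaExp, NNReal.coe_add, add_smul, NormedSpace.exp_add_of_commute
        (((Commute.refl _).smul_left _).smul_right _)]
      rfl
    have e2 : yosidaExp R lam ((s + t : ℝ≥0) : ℝ) f - T s (T t f)
        = yosidaExp R lam s (yosidaExp R lam t f - T t f)
          + (yosidaExp R lam s (T t f) - T s (T t f)) := by
      rw [e, map_sub]; abel
    rw [e2]
    refine (norm_add_le _ _).trans ?_
    gcongr
    exact ContinuousLinearMap.apply_le_of_norm_le_one (H.norm_yosidaExp_le hl s.2) _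
  have hlip : ∀ {f h : X}, (f, h) ∈ A.graph → ∀ t, ‖T t f - f‖ ≤ ‖h‖ * t := by
    intro f h hf t
    refine le_of_tendsto ((hT t f).sub_const f).norm ?_
    filter_upwards [hpos] with lam hl
    have := norm_exp_smul_apply_sub_le t.2 f 0
      (c := ‖h‖) (fun u hu => by
        rw [sub_zero]
        exact (ContinuousLinearMap.apply_le_of_norm_le_one (H.norm_yosidaExp_le hl hu.1) _).trans
          (H.norm_yosida_apply_le hl hf))
    simpa [yosidaExp, NormedSpace.exp_zero] using this
  have hcont0 : ∀ f, Tendsto (fun t => T t f) (𝓝 0) (𝓝 f) := by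
    refine fun f => tendsto_apply_of_dense (V := .id ℝ X) (.of_forall hTn)
      ContinuousLinearMap.norm_id_le H.dense ?_ f
    rintro f ⟨h, hf⟩
    rw [tendsto_iff_norm_sub_tendsto_zero]
    refine squeeze_zero (fun _ => norm_nonneg _) (fun t => hlip hf t) ?_
    have : Tendsto (fun t : ℝ≥0 => ‖h‖ * (t : ℝ)) (𝓝 0) (𝓝 (‖h‖ * ((0 : ℝ≥0) : ℝ))) :=
      (NNReal.continuous_coe.tendsto 0).const_mul _
    simpa using this
  have hcont : ∀ f, Continuous fun t => T t f := by
    intro f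
    have hdiff : ∀ s t : ℝ≥0, s ≤ t → ‖T t f - T s f‖ ≤ ‖T (t - s) f - f‖ := by
      intro s t hst
      have : T t f - T s f = T s (T (t - s) f - f) := by
        rw [map_sub, ← ContinuousLinearMap.comp_apply, ← hTadd, add_tsub_cancel_of_le hst]
      rw [this]
      exact hTa s _
    rw [continuous_iff_continuousAt]
    intro s
    rw [ContinuousAt, tendsto_iff_norm_sub_tendsto_zero]
    -- Subtraction in `ℝ≥0` is truncated, so this sum is `|t - s|`: one of the two terms always
    -- vanishes.
    have h0 : Tendsto (fun t : ℝ≥0 => (t - s) + (s - t)) (𝓝 s) (𝓝 0) := by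
      have : Continuous fun t : ℝ≥0 => (t - s) + (s - t) := by fun_prop
      simpa using this.tendsto s
    have h1 := tendsto_iff_norm_sub_tendsto_zero.1 ((hcont0 f).comp h0)
    refine squeeze_zero (fun _ => norm_nonneg _) (fun t => ?_) h1
    rcases le_total s t with h | h
    · simpa [tsub_eq_zero_of_le h] using hdiff s t h
    · rw [norm_sub_rev]
      simpa [tsub_eq_zero_of_le h] using hdiff t s h
  have hgen : ∀ f h, (f, h) ∈ A.graph →
      Tendsto (fun t : ℝ≥0 => (t : ℝ)⁻¹ • (T t f - f)) (𝓝[>] 0) (𝓝 h) := by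
    intro f h hf
    rw [Metric.tendsto_nhds]
    intro ε hε
    -- The value `h` need not lie in the domain, where alone a Lipschitz bound for orbits uniform in
    -- `lam` is available; it is replaced by a nearby `h'` that does, at the cost of `2 * ‖h - h'‖`.
    obtain ⟨h', hh', ⟨l, hl'⟩⟩ := Metric.dense_iff.1 H.dense h (ε / 4) (by positivity)
    rw [Metric.mem_ball, dist_eq_norm, norm_sub_rev] at hh'
    have hest : ∀ t : ℝ≥0, ‖T t f - f - (t : ℝ) • h‖ ≤ (2 * ‖h - h'‖ + ‖l‖ * t) * t := by
      intro t
      have hlimc : Tendsto (fun lam : ℝ =>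
          (‖yosida R lam f - h‖ + (2 * ‖h - h'‖ + ‖l‖ * t)) * (t : ℝ)) atTop
          (𝓝 ((0 + (2 * ‖h - h'‖ + ‖l‖ * t)) * (t : ℝ))) :=
        ((tendsto_iff_norm_sub_tendsto_zero.1 (H.tendsto_yosida hf)).add_const _).mul_const _
      rw [zero_add] at hlimc
      refine le_of_tendsto_of_tendsto (((hT t f).sub_const f).sub_const _).norm hlimc ?_
      filter_upwards [hpos] with lam hlam
      have := norm_exp_smul_apply_sub_le t.2 f h
        (c := ‖yosida R lam f - h‖ + (2 * ‖h - h'‖ + ‖l‖ * t)) (fun u hu => by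
          change ‖yosidaExp R lam u (yosida R lam f) - h‖ ≤ _
          have e : yosidaExp R lam u (yosida R lam f) - h
              = yosidaExp R lam u (yosida R lam f - h) + (yosidaExp R lam u (h - h')
                - (h - h') + (yosidaExp R lam u h' - h')) := by
            simp only [map_sub]; abel
          have hn := H.norm_yosidaExp_le hlam hu.1
          have h1 := norm_exp_smul_apply_sub_le hu.1 h' 0 (c := ‖l‖) (fun v hv => by
              rw [sub_zero]
              exact (ContinuousLinearMap.apply_le_of_norm_le_one
                (H.norm_yosidaExp_le hlam hv.1) _).trans (H.norm_yosida_apply_le hlam hl'))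
          simp only [NormedSpace.exp_zero, zero_smul, smul_zero, sub_zero,
            one_apply_eq_self] at h1
          have h1' : ‖yosidaExp R lam u h' - h'‖ ≤ ‖l‖ * t :=
            h1.trans (mul_le_mul_of_nonneg_left hu.2.le (norm_nonneg _))
          have h2 := ContinuousLinearMap.apply_le_of_norm_le_one hn (yosida R lam f - h)
          have h3 := ContinuousLinearMap.apply_le_of_norm_le_one hn (h - h')
          have h4 := norm_sub_le (yosidaExp R lam u (h - h')) (h - h')
          rw [e]
          refine (norm_add_le _ _).trans (add_le_add h2 ((norm_add_le _ _).trans ?_))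
          linarith)
      simpa [yosidaExp, NormedSpace.exp_zero] using this
    have hev : ∀ᶠ t : ℝ≥0 in 𝓝[>] 0, ‖l‖ * (t : ℝ) < ε / 2 := by
      refine Eventually.filter_mono nhdsWithin_le_nhds ?_
      have : Continuous fun t : ℝ≥0 => ‖l‖ * (t : ℝ) := by fun_prop
      exact (this.tendsto 0).eventually (gt_mem_nhds (by simpa using by positivity))
    filter_upwards [hev, self_mem_nhdsWithin] with t ht ht0
    have ht0' : (0 : ℝ) < t := ht0
    rw [dist_eq_norm]
    have e : (t : ℝ)⁻¹ • (T t f - f) - h = (t : ℝ)⁻¹ • (T t f - f - (t : ℝ) • h) := by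
      rw [smul_sub _ _ ((t : ℝ) • h), inv_smul_smul₀ ht0'.ne']
    rw [e, norm_smul, Real.norm_of_nonneg (by positivity), inv_mul_lt_iff₀ ht0', mul_comm]
    refine (hest t).trans_lt ?_
    gcongr
    linarith
  refine ⟨T, ⟨hT0, hTadd, hTn, hcont, fun f g => ⟨hgen f g, fun hfg => ?_⟩⟩, hT⟩
  -- Converse inclusion: the generator of `T` extends `A`, and `1 - A` is already onto. With `u` the
  -- solution of `u - A u = f - g`, the vector `w = f - u` is in the domain of the generator and is
  -- fixed by it, which a contraction semigroup permits only for `w = 0`.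
  have hu := H.mem_graph 1 one_pos (f - g)
  set u := R 1 (f - g) with hu_def
  have h1 := hgen _ _ hu
  have h2 : Tendsto (fun t : ℝ≥0 => (t : ℝ)⁻¹ • (T t (f - u) - (f - u))) (𝓝[>] 0)
      (𝓝 (f - u)) := by
    have h3 := hfg.sub h1
    have e : g - ((1 : ℝ) • u - (f - g)) = f - u := by rw [one_smul]; abel
    rw [e] at h3
    refine h3.congr fun t => ?_
    rw [← smul_sub, map_sub]
    congr 1
    abel
  have hw : f - u = 0 := by
    generalize f - u = w at h2 ⊢
    have h4 : Tendsto (fun t : ℝ≥0 => ‖(t : ℝ)⁻¹ • (T t w - w) - w‖) (𝓝[>] 0)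
        (𝓝 0) := tendsto_iff_norm_sub_tendsto_zero.1 h2
    refine norm_le_zero_iff.1 (ge_of_tendsto h4 ?_)
    filter_upwards [self_mem_nhdsWithin] with t ht0
    have ht0' : (0 : ℝ) < t := ht0
    -- Since `‖T t w‖ ≤ ‖w‖`, the bracket has norm at least `t ‖w‖`, so `‖w‖` bounds the vanishing
    -- quantity from below.
    have e : (t : ℝ)⁻¹ • (T t w - w) - w = -((t : ℝ)⁻¹ • ((1 + (t : ℝ)) • w - T t w)) := by
      rw [add_smul, one_smul, smul_sub, smul_sub, smul_add, inv_smul_smul₀ ht0'.ne']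
      abel
    rw [e, norm_neg, norm_smul, Real.norm_of_nonneg (by positivity), le_inv_mul_iff₀ ht0']
    have h5 := norm_sub_norm_le ((1 + (t : ℝ)) • w) (T t w)
    rw [norm_smul, Real.norm_of_nonneg (by positivity)] at h5
    have := hTa t w
    linarith
  have hfu : f = u := sub_eq_zero.1 hw
  rw [← hfu] at hu
  simpa using hu

end HasContractionResolvent

end HilleYosida

/-! ### The Trotter–Kato theorem -/

section TrotterKato

variable {X : Type*} [NormedAddCommGroup X] [NormedSpace ℝ X]

namespace GeneratesContractions

variable {A : X →ₗ.[ℝ] X} {T : ℝ≥0 → X →L[ℝ] X} (G : GeneratesContractions A T)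
include G

theorem apply_add (s t : ℝ≥0) (f : X) : T (s + t) f = T s (T t f) := by
  rw [G.map_add]; rfl

theorem norm_apply_le (t : ℝ≥0) (f : X) : ‖T t f‖ ≤ ‖f‖ :=
  ContinuousLinearMap.apply_le_of_norm_le_one (G.norm_le t) f

theorem map_mem_graph {f h : X} (hf : (f, h) ∈ A.graph) (s : ℝ≥0) :
    (T s f, T s h) ∈ A.graph := by
  rw [G.mem_graph_iff] at hf ⊢
  refine (((T s).continuous.tendsto h).comp hf).congr fun t => ?_
  rw [Function.comp_apply, map_smul, map_sub, ← G.apply_add, ← G.apply_add, add_comm]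

/-- The semigroup maps the graph of `A` into itself, so `T t (R lam g)` solves the resolvent
equation for `T t g`. -/
theorem resolvent_comm {R : ℝ → X →L[ℝ] X} (H : HasContractionResolvent A R) {lam : ℝ}
    (hl : 0 < lam) (t : ℝ≥0) (g : X) : R lam (T t g) = T t (R lam g) := by
  have h1 := H.left_inv lam hl _ _ (G.map_mem_graph (H.mem_graph lam hl g) t)
  rw [map_sub (T t), map_smul (T t), sub_sub_cancel] at h1
  exact h1

theorem hasDerivWithinAt_orbit {f h : X} (hf : (f, h) ∈ A.graph) {s : ℝ} (hs : 0 ≤ s) :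
    HasDerivWithinAt (fun r : ℝ => T r.toNNReal f) (T s.toNNReal h) (Ici s) s := by
  rw [← hasDerivWithinAt_Ioi_iff_Ici, hasDerivWithinAt_iff_tendsto_slope' (by simp)]
  rw [G.mem_graph_iff] at hf
  have hδ : Tendsto (fun r : ℝ => (r - s).toNNReal) (𝓝[>] s) (𝓝[>] 0) := by
    refine tendsto_nhdsWithin_iff.2 ⟨?_, ?_⟩
    · have : Continuous fun r : ℝ => (r - s).toNNReal := by fun_prop
      have h0 := this.tendsto s
      rw [sub_self, Real.toNNReal_zero] at h0
      exact h0.mono_left nhdsWithin_le_nhds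
    · filter_upwards [self_mem_nhdsWithin] with r hr
      simpa using hr
  refine (((T s.toNNReal).continuous.tendsto h).comp (hf.comp hδ)).congr' ?_
  filter_upwards [self_mem_nhdsWithin] with r hr
  have hrs : s < r := hr
  have e : r.toNNReal = s.toNNReal + (r - s).toNNReal := by
    rw [← Real.toNNReal_add hs (by linarith), add_sub_cancel]
  rw [slope_def_module, e, G.apply_add]
  simp only [Function.comp_apply, map_smul, map_sub]
  rw [Real.coe_toNNReal _ (by linarith)]

theorem hasDerivWithinAt_orbit_rev {f h : X} (hf : (f, h) ∈ A.graph) {s t : ℝ} (hst : s < t) :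
    HasDerivWithinAt (fun r : ℝ => T (t - r).toNNReal f) (-(T (t - s).toNNReal h)) (Ici s) s := by
  -- For `s ≤ r < t` the semigroup law gives `T (t - r) f = T (t - s) f + T (t - r) (f - T (r - s)
  -- f)`. The last argument vanishes at `r = s`, so the product rule needs only the strong
  -- continuity of `T (t - r)`, with `v = 0`.
  have hy : HasDerivWithinAt (fun r : ℝ => f - T (r - s).toNNReal f) (-h) (Ici s) s := by
    have h0 := G.hasDerivWithinAt_orbit hf (le_refl (0 : ℝ))
    rw [Real.toNNReal_zero, G.map_zero, ContinuousLinearMap.id_apply] at h0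
    have h1 : HasDerivWithinAt (fun r : ℝ => r - s) 1 (Ici s) s :=
      ((hasDerivAt_id s).sub_const s).hasDerivWithinAt
    have h2 := HasDerivWithinAt.scomp_of_eq s h0 h1 (fun r hr => by simpa using hr) (by simp)
    simpa using h2.const_sub f
  have hc : Continuous fun r : ℝ => T (t - r).toNNReal (-h) :=
    (G.continuous (-h)).comp (by fun_prop : Continuous fun r : ℝ => (t - r).toNNReal)
  have h3 := hasDerivWithinAt_clm_apply_of_strong (U := fun r : ℝ => T (t - r).toNNReal)
    (.of_forall fun r => G.norm_le _) (hc.tendsto s |>.mono_left nhdsWithin_le_nhds)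
    (v := 0) (by
      simp only [sub_self, Real.toNNReal_zero, G.map_zero, ContinuousLinearMap.id_apply]
      simpa using hasDerivWithinAt_const s (Ici s) (0 : X)) hy
  rw [zero_add, map_neg] at h3
  have h4 := h3.add_const (T (t - s).toNNReal f)
  refine h4.congr_of_eventuallyEq ?_ ?_
  · have : ∀ᶠ r in 𝓝[≥] s, r < t := nhdsWithin_le_nhds (Iio_mem_nhds hst)
    filter_upwards [this, self_mem_nhdsWithin] with r hr hr'
    have hr' : s ≤ r := hr'
    have e : (t - s).toNNReal = (t - r).toNNReal + (r - s).toNNReal := by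
      rw [← Real.toNNReal_add (by linarith) (by linarith)]; congr 1; ring
    simp only [e, G.apply_add, map_sub]
    abel
  · simp [G.map_zero]

end GeneratesContractions

/-- The difference of two semigroups, smoothed by the resolvents, is controlled by the difference
of the resolvents. -/
theorem norm_resolvent_semigroup_sub_le {A B : X →ₗ.[ℝ] X} {S T : ℝ≥0 → X →L[ℝ] X}
    {RA RB : ℝ → X →L[ℝ] X} (HA : HasContractionResolvent A RA) (HB : HasContractionResolvent B RB)
    (GA : GeneratesContractions A T) (GB : GeneratesContractions B S) {lam : ℝ} (hl : 0 < lam)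
    (f : X) {t : ℝ≥0} {c : ℝ}
    (hc : ∀ s : ℝ≥0, s ≤ t → ‖RA lam (T s f) - RB lam (T s f)‖ ≤ c) :
    ‖RB lam (T t (RA lam f)) - S t (RB lam (RA lam f))‖ ≤ c * t := by
  -- This path joins the two terms to be compared. From `A RA = lam RA - 1` and `B RB = lam RB - 1`
  -- the `lam` terms cancel in its derivative, and `S (t - s) (RA - RB) T s f` remains.
  set F : ℝ → X := fun s => S (t - s).toNNReal (RB lam (T s.toNNReal (RA lam f))) with hF
  have hd : ∀ s ∈ Ico (0 : ℝ) t, HasDerivWithinAt F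
      (S (t - s).toNNReal (RA lam (T s.toNNReal f) - RB lam (T s.toNNReal f))) (Ici s) s := by
    intro s hs
    have h1 := GA.hasDerivWithinAt_orbit (HA.mem_graph lam hl f) hs.1
    have h2 := (RB lam).hasFDerivAt.comp_hasDerivWithinAt s h1
    have h3 := GB.hasDerivWithinAt_orbit_rev
      (HB.mem_graph lam hl (T s.toNNReal (RA lam f))) hs.2
    have hcont : Continuous fun r : ℝ => S (t - r).toNNReal
        (RB lam (T s.toNNReal (lam • RA lam f - f))) :=
      (GB.continuous _).comp (by fun_prop : Continuous fun r : ℝ => (t - r).toNNReal)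
    have h4 := hasDerivWithinAt_clm_apply_of_strong (U := fun r : ℝ => S (t - r).toNNReal)
      (.of_forall fun r => GB.norm_le _) (hcont.tendsto s |>.mono_left nhdsWithin_le_nhds) h3 h2
    refine h4.congr_deriv ?_
    rw [GA.resolvent_comm HA hl]
    simp only [map_sub, map_smul]
    abel
  have hcont : ContinuousOn F (Icc 0 t) := by
    have : Continuous F := by
      have h1 : Continuous fun s : ℝ => T s.toNNReal (RA lam f) :=
        (GA.continuous _).comp continuous_real_toNNReal
      have h2 : Continuous fun s : ℝ => RB lam (T s.toNNReal (RA lam f)) :=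
        (RB lam).continuous.comp h1
      rw [continuous_iff_continuousAt]
      intro s
      rw [ContinuousAt, tendsto_iff_norm_sub_tendsto_zero]
      have h3 := tendsto_iff_norm_sub_tendsto_zero.1 (h2.tendsto s)
      have h4 : Continuous fun r : ℝ => S (t - r).toNNReal (RB lam (T s.toNNReal (RA lam f))) :=
        (GB.continuous _).comp (by fun_prop : Continuous fun r : ℝ => (t - r).toNNReal)
      have h5 := tendsto_iff_norm_sub_tendsto_zero.1 (h4.tendsto s)
      refine squeeze_zero (fun _ => norm_nonneg _) (fun r => ?_) (by simpa using h3.add h5)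
      have e : F r - F s = S (t - r).toNNReal (RB lam (T r.toNNReal (RA lam f))
          - RB lam (T s.toNNReal (RA lam f))) + (S (t - r).toNNReal
          (RB lam (T s.toNNReal (RA lam f))) - S (t - s).toNNReal
          (RB lam (T s.toNNReal (RA lam f)))) := by
        simp only [hF, map_sub]; abel
      rw [e]
      exact (norm_add_le _ _).trans (add_le_add_left (GB.norm_apply_le _ _) _)
    exact this.continuousOn
  have h := norm_image_sub_le_of_norm_deriv_right_le_segment hcont hd (C := c)
    (fun s hs => (GB.norm_apply_le _ _).trans
      (hc _ (Real.toNNReal_le_iff_le_coe.2 hs.2.le))) t (right_mem_Icc.2 t.2)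
  simpa [hF, GA.map_zero, GB.map_zero] using h

/-- Strongly convergent contractions converge uniformly on compact sets. -/
theorem eventually_norm_apply_sub_le_of_isCompact {ι : Type*} {l : Filter ι} {U : ι → X →L[ℝ] X}
    {V : X →L[ℝ] X} (hU : ∀ᶠ i in l, ‖U i‖ ≤ 1) (hV : ‖V‖ ≤ 1)
    (h : ∀ f, Tendsto (fun i => U i f) l (𝓝 (V f))) {K : Set X} (hK : IsCompact K) {ε : ℝ}
    (hε : 0 < ε) : ∀ᶠ i in l, ∀ f ∈ K, ‖V f - U i f‖ ≤ ε := by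
  obtain ⟨N, hN, hcov⟩ := Metric.totallyBounded_iff.1 hK.totallyBounded (ε / 3) (by positivity)
  have h1 : ∀ᶠ i in l, ∀ g ∈ N, dist (U i g) (V g) < ε / 3 :=
    hN.eventually_all.2 fun g _ => Metric.tendsto_nhds.1 (h g) (ε / 3) (by positivity)
  filter_upwards [hU, h1] with i hi hN f hf
  obtain ⟨g, hg, hfg⟩ := mem_iUnion₂.1 (hcov hf)
  rw [Metric.mem_ball, dist_eq_norm] at hfg
  have h2 := hN g hg
  rw [dist_eq_norm, norm_sub_rev] at h2
  have h3 := ContinuousLinearMap.apply_le_of_norm_le_one hi (f - g)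
  have h4 := ContinuousLinearMap.apply_le_of_norm_le_one hV (f - g)
  have e : V f - U i f = (V g - U i g) + V (f - g) - U i (f - g) := by
    simp only [map_sub]; abel
  rw [e]
  have h5 := norm_sub_le ((V g - U i g) + V (f - g)) (U i (f - g))
  have h6 := norm_add_le (V g - U i g) (V (f - g))
  linarith

theorem HasContractionResolvent.dense_range {A : X →ₗ.[ℝ] X} {R : ℝ → X →L[ℝ] X}
    (H : HasContractionResolvent A R) {lam : ℝ} (hl : 0 < lam) : DenseRange (R lam) :=
  H.dense.mono (by rintro f ⟨h, hf⟩; exact ⟨_, H.left_inv lam hl _ _ hf⟩)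

/-- **Trotter–Kato theorem**: convergence of the resolvents implies convergence of the semigroups,
uniformly on compact time intervals. -/
theorem tendstoUniformlyOn_semigroup {ι : Type*} {l : Filter ι} {A : X →ₗ.[ℝ] X}
    {B : ι → X →ₗ.[ℝ] X} {T : ℝ≥0 → X →L[ℝ] X} {S : ι → ℝ≥0 → X →L[ℝ] X}
    {RA : ℝ → X →L[ℝ] X} {RB : ι → ℝ → X →L[ℝ] X} (HA : HasContractionResolvent A RA)
    (HB : ∀ᶠ i in l, HasContractionResolvent (B i) (RB i)) (GA : GeneratesContractions A T)
    (GB : ∀ᶠ i in l, GeneratesContractions (B i) (S i))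
    (h : ∀ f, Tendsto (fun i => RB i 1 f) l (𝓝 (RA 1 f))) (f : X) {K : Set ℝ≥0}
    (hK : IsCompact K) : TendstoUniformlyOn (fun i t => S i t f) (fun t => T t f) l K := by
  have hRB : ∀ᶠ i in l, ‖RB i 1‖ ≤ 1 := HB.mono fun i HB => by simpa using HB.norm_le 1 one_pos
  have hRA : ‖RA 1‖ ≤ 1 := by simpa using HA.norm_le 1 one_pos
  -- Vectors smoothed twice: the inner resolvent is the one in `norm_resolvent_semigroup_sub_le`,
  -- the outer one is exchanged for `RB i 1`.
  have hD : DenseRange fun f => RA 1 (RA 1 f) :=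
    (HA.dense_range one_pos).comp (HA.dense_range one_pos) (RA 1).continuous
  refine tendstoUniformlyOn_apply_of_dense (GB.mono fun i GB t => GB.norm_le t) GA.norm_le
    hD ?_ f
  rintro _ ⟨f, rfl⟩
  obtain ⟨M, hM⟩ := hK.bddAbove
  set g := RA 1 f with hg
  rw [Metric.tendstoUniformlyOn_iff]
  intro ε hε
  -- Orbits over bounded time intervals are compact, so the resolvents converge uniformly along
  -- them; this is the source of uniformity in `t`.
  have hcomp : ∀ f, IsCompact ((fun t => T t f) '' Icc 0 M) :=
    fun f => isCompact_Icc.image (GA.continuous f)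
  have h1 := eventually_norm_apply_sub_le_of_isCompact hRB hRA h (hcomp f)
    (ε := ε / (4 * (M + 1))) (by positivity)
  have h2 := eventually_norm_apply_sub_le_of_isCompact hRB hRA h (hcomp g)
    (ε := ε / 4) (by positivity)
  have h3 := eventually_norm_apply_sub_le_of_isCompact hRB hRA h
    (isCompact_singleton (x := g)) (ε := ε / 4) (by positivity)
  filter_upwards [h1, h2, h3, HB, GB] with i h1 h2 h3 HB GB t ht
  have htM : t ≤ M := hM ht
  have e1 := norm_resolvent_semigroup_sub_le HA HB GA GB one_pos f (t := t)
    (c := ε / (4 * (M + 1))) fun s hs => h1 _ ⟨s, ⟨zero_le, hs.trans htM⟩, rfl⟩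
  have e2 := h2 _ ⟨t, ⟨zero_le, htM⟩, rfl⟩
  have e3 := (GB.norm_apply_le t _).trans (h3 g rfl)
  have e4 : ε / (4 * (M + 1)) * (t : ℝ) ≤ ε / 4 := by
    have : (t : ℝ) ≤ M + 1 := (NNReal.coe_le_coe.2 htM).trans (by linarith)
    calc _ ≤ ε / (4 * ((M : ℝ) + 1)) * (M + 1) := by gcongr
      _ = ε / 4 := by field_simp
  rw [dist_eq_norm]
  have e : T t (RA 1 g) - S i t (RA 1 g) = (RA 1 (T t g) - RB i 1 (T t g))
      + (RB i 1 (T t g) - S i t (RB i 1 g)) - S i t (RA 1 g - RB i 1 g) := by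
    rw [GA.resolvent_comm HA one_pos, map_sub]; abel
  rw [e]
  have e5 := norm_sub_le ((RA 1 (T t g) - RB i 1 (T t g))
      + (RB i 1 (T t g) - S i t (RB i 1 g))) (S i t (RA 1 g - RB i 1 g))
  have e6 := norm_add_le (RA 1 (T t g) - RB i 1 (T t g)) (RB i 1 (T t g) - S i t (RB i 1 g))
  have e7 := e1.trans e4
  linarith

end TrotterKato

/-! ### From resolvents to Feller generators -/

section FellerGenerator

/-- An operator whose resolvent equation has a unique, suitably bounded solution has a contractive
resolvent. -/
theorem exists_hasContractionResolvent {X : Type*} [NormedAddCommGroup X] [NormedSpace ℝ X]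
    {A : X →ₗ.[ℝ] X} (hD : Dense {f | ∃ h, (f, h) ∈ A.graph})
    (hex : ∀ lam : ℝ, 0 < lam → ∀ g, ∃ f, (f, lam • f - g) ∈ A.graph ∧ ‖f‖ ≤ lam⁻¹ * ‖g‖)
    (hinj : ∀ lam : ℝ, 0 < lam → ∀ f, (f, lam • f) ∈ A.graph → f = 0) :
    ∃ R, HasContractionResolvent A R := by
  have huniq : ∀ lam : ℝ, 0 < lam → ∀ f f' g, (f, lam • f - g) ∈ A.graph →
      (f', lam • f' - g) ∈ A.graph → f = f' := by
    intro lam hl f f' g hf hf'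
    refine sub_eq_zero.1 (hinj lam hl _ ?_)
    have := A.graph.sub_mem hf hf'
    rwa [Prod.mk_sub_mk, sub_sub_sub_cancel_right, ← smul_sub] at this
  have key : ∀ lam : ℝ, ∃ R : X →L[ℝ] X, 0 < lam →
      (∀ g, (R g, lam • R g - g) ∈ A.graph) ∧ ‖R‖ ≤ lam⁻¹ := by
    intro lam
    by_cases hl : 0 < lam
    · choose F hF hFn using hex lam hl
      -- Linearity is a consequence of uniqueness: the sum of two solutions solves the equation for
      -- the sum of the right-hand sides.
      let L : X →ₗ[ℝ] X :=
        { toFun := F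
          map_add' := fun g g' => huniq lam hl _ _ (g + g') (hF _) (by
            have := A.graph.add_mem (hF g) (hF g')
            rwa [Prod.mk_add_mk, sub_add_sub_comm, ← smul_add] at this)
          map_smul' := fun c g => huniq lam hl _ _ (c • g) (hF _) (by
            have := A.graph.smul_mem c (hF g)
            rwa [Prod.smul_mk, smul_sub, smul_comm] at this) }
      refine ⟨L.mkContinuous lam⁻¹ hFn, fun _ => ⟨hF, ?_⟩⟩
      exact L.mkContinuous_norm_le (by positivity) _
    · exact ⟨0, fun h => absurd h hl⟩
  choose R hR using key
  refine ⟨R, fun lam hl g => (hR lam hl).1 g, fun lam hl f h hf => ?_, fun lam hl => ?_, hD⟩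
  · refine huniq lam hl _ _ (lam • f - h) ((hR lam hl).1 _) ?_
    rwa [sub_sub_cancel]
  · rw [norm_smul, Real.norm_of_nonneg hl.le]
    calc lam * ‖R lam‖ ≤ lam * lam⁻¹ := by gcongr; exact (hR lam hl).2
      _ = 1 := mul_inv_cancel₀ hl.ne'

open NormedSpace in
-- The partial sums of the series of `exp (s • K)` have nonnegative coefficients, so they preserve
-- the cone; closedness passes this to the limit, and `e^{-s}` is a positive factor.
theorem exp_smul_sub_one_mem_cone {X : Type*} [NormedAddCommGroup X] [NormedSpace ℝ X]
    [CompleteSpace X] {P : PointedCone ℝ X} (hP : IsClosed (P : Set X)) {K : X →L[ℝ] X}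
    (hK : ∀ f ∈ P, K f ∈ P) {s : ℝ} (hs : 0 ≤ s) {f : X} (hf : f ∈ P) :
    exp (s • (K - 1)) f ∈ P := by
  have h1 := exp_series_hasSum_exp' (𝕂 := ℝ) (s • K)
  have h2 := h1.mapL (ContinuousLinearMap.apply ℝ X f)
  have h3 : ∀ n : ℕ, (K ^ n) f ∈ P := by
    intro n
    induction n with
    | zero => exact hf
    | succ n ih => rw [pow_succ']; exact hK _ ih
  have h4 : exp (s • K) f ∈ P := by
    refine hP.mem_of_tendsto h2 (.of_forall fun t => sum_mem fun n _ => ?_)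
    rw [ContinuousLinearMap.apply_apply, smul_pow, smul_apply, smul_apply]
    exact PointedCone.smul_mem _ (by positivity) (PointedCone.smul_mem _ (by positivity) (h3 n))
  rw [exp_smul_sub_one, smul_apply]
  exact PointedCone.smul_mem _ (Real.exp_pos _).le h4

variable {S : Type*} [TopologicalSpace S] [CompactSpace S]

theorem HasContractionResolvent.isResolventAt {A : C(S, ℝ) →ₗ.[ℝ] C(S, ℝ)}
    {R : ℝ → C(S, ℝ) →L[ℝ] C(S, ℝ)} (H : HasContractionResolvent A R) {lam : ℝ} (hl : 0 < lam) :
    IsResolventAt A lam (R lam) := by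
  refine ⟨fun g => ?_, fun f => H.left_inv lam hl _ _ (A.mem_graph f)⟩
  obtain ⟨y, hy, hy'⟩ := A.mem_graph_iff.1 (H.mem_graph lam hl g)
  have hmem : R lam g ∈ A.domain := by
    have : (y : C(S, ℝ)) = R lam g := hy
    exact this ▸ y.2
  refine ⟨hmem, ?_⟩
  have : y = ⟨R lam g, hmem⟩ := Subtype.ext hy
  rw [← this, hy', sub_sub_cancel]

theorem Generates.generatesContractions {A : C(S, ℝ) →ₗ.[ℝ] C(S, ℝ)}
    {T : ℝ≥0 → C(S, ℝ) →L[ℝ] C(S, ℝ)} (h : Generates A T) : GeneratesContractions A T :=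
  ⟨h.1.map_zero, h.1.map_add, h.1.contraction, h.1.strongly_continuous, h.2⟩

theorem HasContractionResolvent.isFellerGenerator {A : C(S, ℝ) →ₗ.[ℝ] C(S, ℝ)}
    {R : ℝ → C(S, ℝ) →L[ℝ] C(S, ℝ)} (H : HasContractionResolvent A R)
    (hpos : ∀ lam, 0 < lam → ∀ g, 0 ≤ g → 0 ≤ R lam g) : IsFellerGenerator A := by
  obtain ⟨T, hT, hlim⟩ := H.exists_semigroup
  refine ⟨T, ⟨hT.map_zero, hT.map_add, fun t f hf => ?_, hT.norm_le, hT.continuous⟩,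
    hT.mem_graph_iff⟩
  have hP : IsClosed (PointedCone.positive ℝ C(S, ℝ) : Set C(S, ℝ)) := by
    have : (PointedCone.positive ℝ C(S, ℝ) : Set C(S, ℝ)) = ⋂ p, {f | 0 ≤ f p} := by
      ext f
      simp [ContinuousMap.le_def]
    rw [this]
    exact isClosed_iInter fun p => isClosed_le continuous_const (continuous_eval_const p)
  refine hP.mem_of_tendsto (hlim t f) ?_
  filter_upwards [eventually_gt_atTop 0] with lam hl
  rw [yosidaExp, yosida, smul_smul]
  exact exp_smul_sub_one_mem_cone hP (fun f hf => smul_nonneg hl.le (hpos lam hl f hf))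
    (by positivity) hf

end FellerGenerator

/-! ## The resolvent of the Brownian motion on a half-line killed at the origin -/

section HalfLine

/-- The resolvent of the killed Brownian motion on the half-line, in a form that is differentiable
on the whole line; here `a = √(2 lam)`. -/
def halfLinePotential (a : ℝ) (φ : ℝ → ℝ) (x : ℝ) : ℝ :=
  1 / a * (Real.exp (-a * x) * (∫ y in (0 : ℝ)..x, Real.exp (a * y) * φ y)
    + Real.exp (a * x) * ((∫ y in Ioi (0 : ℝ), Real.exp (-a * y) * φ y)
      - ∫ y in (0 : ℝ)..x, Real.exp (-a * y) * φ y)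
    - Real.exp (-a * x) * ∫ y in Ioi (0 : ℝ), Real.exp (-a * y) * φ y)

/-- The derivative of `halfLinePotential`. -/
def halfLinePotentialDeriv (a : ℝ) (φ : ℝ → ℝ) (x : ℝ) : ℝ :=
  -(Real.exp (-a * x) * (∫ y in (0 : ℝ)..x, Real.exp (a * y) * φ y))
    + Real.exp (a * x) * ((∫ y in Ioi (0 : ℝ), Real.exp (-a * y) * φ y)
      - ∫ y in (0 : ℝ)..x, Real.exp (-a * y) * φ y)
    + Real.exp (-a * x) * ∫ y in Ioi (0 : ℝ), Real.exp (-a * y) * φ y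

variable {a : ℝ} {φ : ℝ → ℝ}

theorem hasDerivAt_exp_const_mul (c x : ℝ) :
    HasDerivAt (fun x => Real.exp (c * x)) (c * Real.exp (c * x)) x := by
  have := ((hasDerivAt_id x).const_mul c).exp
  simpa [mul_comm] using this

theorem hasDerivAt_integral_exp_mul (hφ : Continuous φ) (c x : ℝ) :
    HasDerivAt (fun x => ∫ y in (0 : ℝ)..x, Real.exp (c * y) * φ y) (Real.exp (c * x) * φ x) x :=
  (Continuous.integral_hasStrictDerivAt (by fun_prop) 0 x).hasDerivAt

theorem hasDerivAt_halfLinePotential (ha : a ≠ 0) (hφ : Continuous φ) (x : ℝ) :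
    HasDerivAt (halfLinePotential a φ) (halfLinePotentialDeriv a φ x) x := by
  have h1 := hasDerivAt_exp_const_mul (-a) x
  have h2 := hasDerivAt_exp_const_mul a x
  have h3 := hasDerivAt_integral_exp_mul hφ a x
  have h4 := hasDerivAt_integral_exp_mul hφ (-a) x
  have h := (((h1.mul h3).add (h2.mul (h4.const_sub
    (∫ y in Ioi (0 : ℝ), Real.exp (-a * y) * φ y)))).sub
    (h1.mul_const (∫ y in Ioi (0 : ℝ), Real.exp (-a * y) * φ y))).const_mul (1 / a)
  refine h.congr_deriv ?_
  have e : Real.exp (-a * x) * Real.exp (a * x) = 1 := by rw [← Real.exp_add]; simp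
  rw [halfLinePotentialDeriv]
  field_simp
  ring

theorem hasDerivAt_halfLinePotentialDeriv (ha : a ≠ 0) (hφ : Continuous φ) (x : ℝ) :
    HasDerivAt (halfLinePotentialDeriv a φ) (a ^ 2 * halfLinePotential a φ x - 2 * φ x) x := by
  have h1 := hasDerivAt_exp_const_mul (-a) x
  have h2 := hasDerivAt_exp_const_mul a x
  have h3 := hasDerivAt_integral_exp_mul hφ a x
  have h4 := hasDerivAt_integral_exp_mul hφ (-a) x
  have h := (((h1.mul h3).neg.add (h2.mul (h4.const_sub
    (∫ y in Ioi (0 : ℝ), Real.exp (-a * y) * φ y)))).add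
    (h1.mul_const (∫ y in Ioi (0 : ℝ), Real.exp (-a * y) * φ y)))
  refine h.congr_deriv ?_
  have e : Real.exp (-a * x) * Real.exp (a * x) = 1 := by rw [← Real.exp_add]; simp
  rw [halfLinePotential, ← mul_assoc (a ^ 2), show a ^ 2 * (1 / a) = a by field_simp]
  linear_combination (-2 * φ x) * e

theorem halfLinePotential_zero : halfLinePotential a φ 0 = 0 := by
  simp [halfLinePotential]

theorem halfLinePotentialDeriv_zero :
    halfLinePotentialDeriv a φ 0 = 2 * ∫ y in Ioi (0 : ℝ), Real.exp (-a * y) * φ y := by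
  simp [halfLinePotentialDeriv]; ring

theorem integrableOn_exp_neg_mul (ha : 0 < a) (c : ℝ) :
    IntegrableOn (fun y => Real.exp (-a * y)) (Ioi c) :=
  integrableOn_exp_mul_Ioi (by linarith) c

theorem integrableOn_exp_neg_mul_mul (ha : 0 < a) (hφ : Continuous φ) {M : ℝ}
    (hM : ∀ y, |φ y| ≤ M) (c : ℝ) :
    IntegrableOn (fun y => Real.exp (-a * y) * φ y) (Ioi c) :=
  (integrableOn_exp_neg_mul ha c).mul_bdd (c := M) hφ.aestronglyMeasurable
    (.of_forall fun y => by simpa using hM y)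

theorem integrableOn_killedKernel_mul (ha : 0 < a) (hφ : Continuous φ) {M : ℝ}
    (hM : ∀ y, |φ y| ≤ M) (x : ℝ) :
    IntegrableOn (fun y => (Real.exp (-a * |x - y|) - Real.exp (-a * (x + y))) * φ y)
      (Ioi 0) := by
  have hk : IntegrableOn (fun y => Real.exp (-a * |x - y|) - Real.exp (-a * (x + y)))
      (Ioi 0) := by
    refine Integrable.mono' (((integrableOn_exp_neg_mul ha 0).const_mul
      (Real.exp (a * x) + Real.exp (-a * x)))) (by fun_prop) (.of_forall fun y => ?_)
    refine (norm_sub_le _ _).trans ?_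
    rw [Real.norm_of_nonneg (Real.exp_pos _).le, Real.norm_of_nonneg (Real.exp_pos _).le, add_mul,
      ← Real.exp_add, ← Real.exp_add]
    refine add_le_add (Real.exp_le_exp.2 ?_) (Real.exp_le_exp.2 (by linarith))
    nlinarith [neg_abs_le (x - y)]
  exact hk.mul_bdd (c := M) hφ.aestronglyMeasurable (.of_forall fun y => by simpa using hM y)

theorem killedKernel_nonneg (ha : 0 < a) {x y : ℝ} (hx : 0 ≤ x) (hy : 0 ≤ y) :
    0 ≤ Real.exp (-a * |x - y|) - Real.exp (-a * (x + y)) := by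
  refine sub_nonneg.2 (Real.exp_le_exp.2 ?_)
  have : |x - y| ≤ x + y := abs_le.2 ⟨by linarith, by linarith⟩
  nlinarith

/-- The integral is split at `y = x`, where the absolute value changes sign; the factors depending
on `x` then come out of the integrals. -/
theorem integral_killedKernel_mul (ha : 0 < a) (hφ : Continuous φ) {M : ℝ}
    (hM : ∀ y, |φ y| ≤ M) {x : ℝ} (hx : 0 ≤ x) :
    1 / a * ∫ y in Ioi (0 : ℝ), (Real.exp (-a * |x - y|) - Real.exp (-a * (x + y))) * φ y
      = halfLinePotential a φ x := by
  have hint := integrableOn_killedKernel_mul ha hφ hM x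
  have hI := integrableOn_exp_neg_mul_mul ha hφ hM 0
  have hII : ∀ c : ℝ, IntervalIntegrable (fun y => Real.exp (c * y) * φ y) volume 0 x :=
    fun c => (by fun_prop : Continuous fun y => Real.exp (c * y) * φ y).intervalIntegrable _ _
  have hsplit := intervalIntegral.integral_Ioi_sub_Ioi hint hx
  have hsplit2 := intervalIntegral.integral_Ioi_sub_Ioi hI hx
  have h1 : (∫ y in (0 : ℝ)..x, (Real.exp (-a * |x - y|) - Real.exp (-a * (x + y))) * φ y)
      = Real.exp (-a * x) * (∫ y in (0 : ℝ)..x, Real.exp (a * y) * φ y)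
        - Real.exp (-a * x) * ∫ y in (0 : ℝ)..x, Real.exp (-a * y) * φ y := by
    rw [← intervalIntegral.integral_const_mul, ← intervalIntegral.integral_const_mul,
      ← intervalIntegral.integral_sub ((hII a).const_mul _) ((hII (-a)).const_mul _)]
    refine intervalIntegral.integral_congr fun y hy => ?_
    rw [uIcc_of_le hx] at hy
    rw [abs_of_nonneg (by linarith [hy.2]), ← mul_assoc, ← mul_assoc, ← Real.exp_add,
      ← Real.exp_add, ← sub_mul]
    congr 3 <;> ring_nf
  have h2 : (∫ y in Ioi x, (Real.exp (-a * |x - y|) - Real.exp (-a * (x + y))) * φ y)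
      = Real.exp (a * x) * (∫ y in Ioi x, Real.exp (-a * y) * φ y)
        - Real.exp (-a * x) * ∫ y in Ioi x, Real.exp (-a * y) * φ y := by
    have hIx := integrableOn_exp_neg_mul_mul ha hφ hM x
    rw [← integral_const_mul, ← integral_const_mul,
      ← integral_sub (hIx.const_mul _) (hIx.const_mul _)]
    refine setIntegral_congr_fun measurableSet_Ioi fun y hy => ?_
    rw [abs_of_nonpos (by linarith [mem_Ioi.1 hy]), ← mul_assoc, ← mul_assoc, ← Real.exp_add,
      ← Real.exp_add, ← sub_mul]
    congr 3 <;> ring_nf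
  rw [halfLinePotential, ← hsplit2]
  rw [sub_eq_iff_eq_add] at hsplit
  rw [hsplit, h1, h2, ← hsplit2]
  ring

theorem halfLinePotential_one (ha : 0 < a) (x : ℝ) :
    halfLinePotential a 1 x = 2 / a ^ 2 * (1 - Real.exp (-a * x)) := by
  have e : Real.exp (-a * x) * Real.exp (a * x) = 1 := by rw [← Real.exp_add]; simp
  have h1 : ∀ c : ℝ, c ≠ 0 → ∫ y in (0 : ℝ)..x, Real.exp (c * y) = (Real.exp (c * x) - 1) / c := by
    intro c hc
    have := intervalIntegral.integral_eq_sub_of_hasDerivAt (a := 0) (b := x)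
      (f := fun y => Real.exp (c * y) / c) (f' := fun y => Real.exp (c * y))
      (fun y _ => ((hasDerivAt_exp_const_mul c y).div_const c).congr_deriv (by field_simp))
      ((by fun_prop : Continuous fun y => Real.exp (c * y)).intervalIntegrable _ _)
    rw [this, mul_zero, Real.exp_zero, sub_div]
  have h2 : ∫ y in Ioi (0 : ℝ), Real.exp (-a * y) = 1 / a := by
    rw [integral_exp_mul_Ioi (by linarith)]
    simp
  simp only [halfLinePotential, Pi.one_apply, mul_one]
  rw [h1 a ha.ne', h1 (-a) (neg_ne_zero.2 ha.ne'), h2]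
  field_simp
  have e' : Real.exp (-(a * x)) * Real.exp (a * x) = 1 := by rw [← Real.exp_add]; simp
  linear_combination 2 * e'

/-- The parts left and right of `x` become, after the substitutions `y = x - z` and `y = x + z`,
integrals of `φ` against `exp (-a z)`. Each tends to `L / a` by dominated convergence, and the
reflected term decays. -/
theorem tendsto_halfLinePotential (ha : 0 < a) (hφ : Continuous φ) {M L : ℝ}
    (hM : ∀ y, |φ y| ≤ M) (hL : Tendsto φ atTop (𝓝 L)) :
    Tendsto (halfLinePotential a φ) atTop (𝓝 (2 / a ^ 2 * L)) := by
  have hint := integrableOn_exp_neg_mul ha 0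
  have hval : ∫ z in Ioi (0 : ℝ), Real.exp (-a * z) * L = L / a := by
    rw [integral_mul_const, integral_exp_mul_Ioi (by linarith)]
    simp; field_simp
  have h1 : Tendsto (fun x => Real.exp (-a * x) * (∫ y in (0 : ℝ)..x, Real.exp (a * y) * φ y))
      atTop (𝓝 (L / a)) := by
    have e : ∀ᶠ x in atTop, (∫ z in Ioi (0 : ℝ), (Iic x).indicator
        (fun z => Real.exp (-a * z) * φ (x - z)) z)
        = Real.exp (-a * x) * (∫ y in (0 : ℝ)..x, Real.exp (a * y) * φ y) := by
      filter_upwards [eventually_ge_atTop 0] with x hx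
      rw [setIntegral_indicator measurableSet_Iic, Ioi_inter_Iic,
        ← intervalIntegral.integral_of_le hx, ← intervalIntegral.integral_const_mul]
      have := intervalIntegral.integral_comp_sub_left (a := 0) (b := x)
        (fun y => Real.exp (-a * x) * (Real.exp (a * y) * φ y)) x
      rw [sub_self, sub_zero] at this
      rw [← this]
      congr 1
      ext z
      rw [← mul_assoc, ← Real.exp_add]
      ring_nf
    refine Tendsto.congr' e ?_
    rw [← hval]
    refine tendsto_integral_filter_of_dominated_convergence
      (fun z => Real.exp (-a * z) * M) ?_ ?_ (hint.mul_const M) ?_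
    · refine .of_forall fun x => AEStronglyMeasurable.indicator ?_ measurableSet_Iic
      fun_prop
    · refine .of_forall fun x => .of_forall fun z => ?_
      refine (norm_indicator_le_norm_self _ _).trans ?_
      rw [norm_mul, Real.norm_of_nonneg (Real.exp_pos _).le]
      exact mul_le_mul_of_nonneg_left (hM _) (Real.exp_pos _).le
    · refine .of_forall fun z => ?_
      have h0 : Tendsto (fun x => Real.exp (-a * z) * φ (x - z)) atTop
          (𝓝 (Real.exp (-a * z) * L)) :=
        (hL.comp (tendsto_atTop_add_const_right _ (-z) tendsto_id)).const_mul _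
      refine h0.congr' ?_
      filter_upwards [eventually_ge_atTop z] with x hx
      rw [indicator_of_mem (mem_Iic.2 hx)]
  have h2 : Tendsto (fun x => Real.exp (a * x) * ((∫ y in Ioi (0 : ℝ), Real.exp (-a * y) * φ y)
      - ∫ y in (0 : ℝ)..x, Real.exp (-a * y) * φ y)) atTop (𝓝 (L / a)) := by
    have e : ∀ᶠ x in atTop, (∫ z in Ioi (0 : ℝ), Real.exp (-a * z) * φ (x + z))
        = Real.exp (a * x) * ((∫ y in Ioi (0 : ℝ), Real.exp (-a * y) * φ y)
      - ∫ y in (0 : ℝ)..x, Real.exp (-a * y) * φ y) := by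
      filter_upwards [eventually_ge_atTop 0] with x hx
      rw [← intervalIntegral.integral_Ioi_sub_Ioi (integrableOn_exp_neg_mul_mul ha hφ hM 0) hx,
        sub_sub_cancel, ← integral_const_mul]
      have := (measurePreserving_add_left volume x).setIntegral_preimage_emb
        (measurableEmbedding_addLeft x)
        (fun y => Real.exp (a * x) * (Real.exp (-a * y) * φ y)) (Ioi x)
      rw [preimage_const_add_Ioi, sub_self] at this
      rw [← this]
      congr 1
      ext z
      rw [← mul_assoc, ← Real.exp_add]
      ring_nf
    refine Tendsto.congr' e ?_
    rw [← hval]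
    refine tendsto_integral_filter_of_dominated_convergence
      (fun z => Real.exp (-a * z) * M) ?_ ?_ (hint.mul_const M) ?_
    · exact .of_forall fun x => by fun_prop
    · refine .of_forall fun x => .of_forall fun z => ?_
      rw [norm_mul, Real.norm_of_nonneg (Real.exp_pos _).le]
      exact mul_le_mul_of_nonneg_left (hM _) (Real.exp_pos _).le
    · exact .of_forall fun z =>
        (hL.comp (tendsto_atTop_add_const_right _ z tendsto_id)).const_mul _
  have h0 : Tendsto (fun x => Real.exp (-a * x)) atTop (𝓝 0) :=
    Real.tendsto_exp_atBot.comp (tendsto_id.const_mul_atTop_of_neg (by linarith))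
  have h3 := h0.mul_const (∫ y in Ioi (0 : ℝ), Real.exp (-a * y) * φ y)
  have h := ((h1.add h2).sub h3).const_mul (1 / a)
  have e : 1 / a * (L / a + L / a - 0 * ∫ y in Ioi (0 : ℝ), Real.exp (-a * y) * φ y)
      = 2 / a ^ 2 * L := by
    field_simp; ring
  rw [e] at h
  exact h

/-- A bounded solution of `w'' = a² w` on the half-line that vanishes at `0` is zero. -/
theorem eq_zero_of_bounded_of_deriv_deriv_eq (ha : 0 < a) {w w' : ℝ → ℝ}
    (h1 : ∀ x, 0 ≤ x → HasDerivWithinAt w (w' x) (Ici 0) x)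
    (h2 : ∀ x, 0 ≤ x → HasDerivWithinAt w' (a ^ 2 * w x) (Ici 0) x) {M : ℝ}
    (hM : ∀ x, 0 ≤ x → |w x| ≤ M) (h0 : w 0 = 0) {x : ℝ} (hx : 0 ≤ x) : w x = 0 := by
  have hconst : ∀ f : ℝ → ℝ, (∀ x, 0 ≤ x → HasDerivWithinAt f 0 (Ici 0) x) →
      ∀ x, 0 ≤ x → f x = f 0 := by
    intro f hf x hx
    refine constant_of_has_deriv_right_zero (b := x)
      (fun y hy => (hf y hy.1).continuousWithinAt.mono Icc_subset_Ici_self)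
      (fun y hy => (hf y hy.1).mono (Ici_subset_Ici.2 hy.1)) x (right_mem_Icc.2 hx)
  -- The operator `w'' - a² w` factors as `(d/dx - c)(d/dx + c)`. Taking `c = a` and `c = -a`
  -- determines `w` as a multiple of `sinh (a x)`, and boundedness then forces `w' 0 = 0`.
  have key : ∀ c : ℝ, c ^ 2 = a ^ 2 → ∀ x, 0 ≤ x →
      Real.exp (-c * x) * (w' x + c * w x) = w' 0 := by
    intro c hc x hx
    have := hconst (fun x => Real.exp (-c * x) * (w' x + c * w x)) (fun x hx => by
      have h3 := (hasDerivAt_exp_const_mul (-c) x).hasDerivWithinAt (s := Ici 0)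
      refine (h3.mul ((h2 x hx).add ((h1 x hx).const_mul c))).congr_deriv ?_
      rw [← hc, Pi.add_apply]; ring) x hx
    rw [this]; simp [h0]
  have hw : ∀ x, 0 ≤ x → 2 * a * w x = w' 0 * (Real.exp (a * x) - Real.exp (-a * x)) := by
    intro x hx
    have e1 := key a rfl x hx
    have e2 := key (-a) (by ring) x hx
    rw [neg_neg] at e2
    have e : Real.exp (-a * x) * Real.exp (a * x) = 1 := by rw [← Real.exp_add]; simp
    linear_combination (Real.exp (a * x)) * e1 - (Real.exp (-a * x)) * e2 - 2 * a * w x * e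
  have hw0 : w' 0 = 0 := by
    by_contra hne
    have ht : Tendsto (fun x => |w' 0| * (Real.exp (a * x) - 1)) atTop atTop :=
      (tendsto_atTop_add_const_right _ (-1) (Real.tendsto_exp_atTop.comp
        (tendsto_id.const_mul_atTop ha))).const_mul_atTop (abs_pos.2 hne)
    obtain ⟨x, hx, hx'⟩ := ((eventually_ge_atTop 0).and
      (ht.eventually_gt_atTop (2 * a * M))).exists
    have e1 := hw x hx
    have e2 : |2 * a * w x| = |w' 0| * (Real.exp (a * x) - Real.exp (-a * x)) := by
      rw [e1, abs_mul, abs_of_nonneg (sub_nonneg.2 (Real.exp_le_exp.2 (by nlinarith)))]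
    rw [abs_mul, abs_of_pos (by positivity)] at e2
    have e3 : Real.exp (-a * x) ≤ 1 := Real.exp_le_one_iff.2 (by nlinarith)
    have e4 : |w' 0| * (Real.exp (a * x) - 1)
        ≤ |w' 0| * (Real.exp (a * x) - Real.exp (-a * x)) := by gcongr
    have e5 : 2 * a * |w x| ≤ 2 * a * M :=
      mul_le_mul_of_nonneg_left (hM x hx) (by positivity)
    linarith
  have := hw x hx
  rw [hw0, zero_mul] at this
  have h2a : 2 * a ≠ 0 := by positivity
  exact (mul_eq_zero.1 this).resolve_left h2a

end HalfLine

/-! ### Continuous functions on the star graph -/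

namespace StarGraph

variable {k : ℕ}

theorem exists_edge (p : StarGraph k) : ∃ i x, p = edge i x := by
  obtain ⟨⟨i, x⟩, rfl⟩ := Quotient.exists_rep p
  exact ⟨i, x, rfl⟩

@[simp] theorem radius_edge (i : Fin k) (x : ℝ≥0∞) : radius (edge i x) = x := rfl

theorem eq_center_of_radius_eq_zero [NeZero k] {p : StarGraph k} (h : radius p = 0) :
    p = center := by
  obtain ⟨i, x, rfl⟩ := exists_edge p
  rw [radius_edge] at h
  rw [h, edge_zero]

@[simp] theorem radius_center [NeZero k] : radius (center : StarGraph k) = 0 := rfl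

theorem continuous_radius : Continuous (radius : StarGraph k → ℝ≥0∞) :=
  continuous_snd.quotient_lift _

theorem continuous_ite_top {φ : ℝ → ℝ} (hφ : Continuous φ) {L : ℝ}
    (hL : Tendsto φ atTop (𝓝 L)) :
    Continuous fun x : ℝ≥0∞ => if x = ∞ then L else φ x.toReal := by
  rw [continuous_iff_continuousAt]
  intro x
  by_cases hx : x = ∞
  · subst hx
    rw [ContinuousAt, if_pos rfl]
    refine tendsto_def.2 fun V hV => ?_
    obtain ⟨N, hN⟩ := eventually_atTop.1 (hL.eventually hV)
    filter_upwards [Ioi_mem_nhds (ENNReal.ofReal_lt_top (r := N))] with y hy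
    rw [mem_preimage]
    split_ifs with h
    · exact mem_of_mem_nhds hV
    · exact hN _ ((ENNReal.ofReal_le_iff_le_toReal h).1 (mem_Ioi.1 hy).le)
  · have h1 : ContinuousAt (fun x : ℝ≥0∞ => φ x.toReal) x :=
      hφ.continuousAt.comp (ENNReal.continuousAt_toReal hx)
    refine h1.congr ?_
    filter_upwards [isOpen_ne.mem_nhds hx] with y hy
    rw [if_neg hy]

/-- Continuous functions on the edges that have limits at infinity and agree at the center form
a continuous function on the graph. -/
theorem exists_of_arms {φ : Fin k → ℝ → ℝ} (hφ : ∀ i, Continuous (φ i)) {L : Fin k → ℝ}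
    (hL : ∀ i, Tendsto (φ i) atTop (𝓝 (L i))) {c : ℝ} (hc : ∀ i, φ i 0 = c) :
    ∃ f : C(StarGraph k, ℝ), ∀ i x, f (edge i x) = if x = ∞ then L i else φ i x.toReal := by
  let F : Fin k × ℝ≥0∞ → ℝ := fun p => if p.2 = ∞ then L p.1 else φ p.1 p.2.toReal
  have hF : Continuous F :=
    continuous_prod_of_discrete_left.2 fun i => continuous_ite_top (hφ i) (hL i)
  have hr : ∀ p q, (starSetoid k).r p q → F p = F q := by
    rintro p q (rfl | h)
    · rfl
    · simp [F, h.1, h.2, hc]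
  exact ⟨⟨Quotient.lift F hr, hF.quotient_lift hr⟩, fun i x => rfl⟩

theorem arm_eq_of_edge {f : C(StarGraph k, ℝ)} {φ : ℝ → ℝ} {L : ℝ} {i : Fin k}
    (h : ∀ x, f (edge i x) = if x = ∞ then L else φ x.toReal) {x : ℝ} (hx : 0 ≤ x) :
    arm f i x = φ x := by
  rw [arm, h, if_neg ENNReal.ofReal_ne_top, ENNReal.toReal_ofReal hx]

theorem continuous_arm (f : C(StarGraph k, ℝ)) (i : Fin k) : Continuous (arm f i) :=
  f.continuous.comp ((continuous_edge i).comp ENNReal.continuous_ofReal)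

theorem abs_arm_le (f : C(StarGraph k, ℝ)) (i : Fin k) (x : ℝ) : |arm f i x| ≤ ‖f‖ :=
  f.norm_coe_le_norm _

theorem tendsto_arm (f : C(StarGraph k, ℝ)) (i : Fin k) :
    Tendsto (arm f i) atTop (𝓝 (f (edge i ∞))) :=
  ((f.continuous.comp (continuous_edge i)).tendsto ∞).comp ENNReal.tendsto_ofReal_atTop

/-! ### Second derivatives -/

/-- Replaces iterated derivatives by explicit first-order ones. Continuity of the second derivative
is free, since `h` is continuous on the graph. -/
theorem isSecondDeriv_of_hasDerivWithinAt {f h : C(StarGraph k, ℝ)} {f' : Fin k → ℝ → ℝ}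
    (h1 : ∀ i x, 0 ≤ x → HasDerivWithinAt (arm f i) (f' i x) (Ici 0) x)
    (h2 : ∀ i x, 0 ≤ x → HasDerivWithinAt (f' i) (arm h i x) (Ici 0) x) :
    IsSecondDeriv f h ∧ ∀ i, slope f i = f' i 0 := by
  have hu := uniqueDiffOn_Ici (0 : ℝ)
  have e1 : ∀ i, EqOn (derivWithin (arm f i) (Ici 0)) (f' i) (Ici 0) := fun i x hx =>
    (h1 i x hx).derivWithin (hu x hx)
  have d2 : ∀ i x, 0 ≤ x →
      HasDerivWithinAt (derivWithin (arm f i) (Ici 0)) (arm h i x) (Ici 0) x := fun i x hx =>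
    (h2 i x hx).congr (e1 i) (e1 i hx)
  have e2 : ∀ i, EqOn (derivWithin (derivWithin (arm f i) (Ici 0)) (Ici 0)) (arm h i) (Ici 0) :=
    fun i x hx => (d2 i x hx).derivWithin (hu x hx)
  refine ⟨fun i => ⟨?_, fun x hx => ?_⟩, fun i => e1 i self_mem_Ici⟩
  · have h2' : ContDiffOn ℝ 1 (derivWithin (arm f i) (Ici 0)) (Ici 0) := by
      have := (contDiffOn_succ_iff_derivWithin (n := 0) hu).2
        ⟨fun x hx => (d2 i x hx).differentiableWithinAt, by simp, contDiffOn_zero.2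
          ((continuous_arm h i).continuousOn.congr (e2 i))⟩
      simpa using this
    have := (contDiffOn_succ_iff_derivWithin (n := 1) hu).2
      ⟨fun x hx => (h1 i x hx).differentiableWithinAt, by simp, h2'⟩
    rwa [one_add_one_eq_two] at this
  · rw [iteratedDerivWithin_succ, iteratedDerivWithin_one]
    exact e2 i hx

theorem IsSecondDeriv.hasDerivWithinAt {f h : C(StarGraph k, ℝ)} (H : IsSecondDeriv f h)
    (i : Fin k) {x : ℝ} (hx : 0 ≤ x) :
    HasDerivWithinAt (arm f i) (derivWithin (arm f i) (Ici 0) x) (Ici 0) x ∧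
    HasDerivWithinAt (derivWithin (arm f i) (Ici 0)) (arm h i x) (Ici 0) x := by
  have hu := uniqueDiffOn_Ici (0 : ℝ)
  have hc := (H i).1
  refine ⟨(hc.differentiableOn (by norm_num) x hx).hasDerivWithinAt, ?_⟩
  rw [← (H i).2 x hx, iteratedDerivWithin_succ, iteratedDerivWithin_one]
  rw [← one_add_one_eq_two] at hc
  exact (((contDiffOn_succ_iff_derivWithin hu).1 hc).2.2.differentiableOn (by norm_num) x
    hx).hasDerivWithinAt

theorem secondDeriv_spec {f : C(StarGraph k, ℝ)} (hf : f ∈ C2 k) :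
    IsSecondDeriv f (secondDeriv k ⟨f, hf⟩) := hf.choose_spec

theorem IsSecondDeriv.slope_add {f h g l : C(StarGraph k, ℝ)} (H : IsSecondDeriv f h)
    (H' : IsSecondDeriv g l) (i : Fin k) : slope (f + g) i = slope f i + slope g i :=
  StarGraph.slope_add ⟨h, H⟩ ⟨l, H'⟩ i

/-- A function with `f'' = 2 lam f` that vanishes at the center is zero. -/
theorem IsSecondDeriv.eq_zero [NeZero k] {f : C(StarGraph k, ℝ)} {lam : ℝ} (hl : 0 < lam)
    (H : IsSecondDeriv f ((2 * lam) • f)) (h0 : f center = 0) : f = 0 := by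
  have ha : 0 < √(2 * lam) := Real.sqrt_pos.2 (by positivity)
  refine ext_arm fun i x hx => ?_
  refine eq_zero_of_bounded_of_deriv_deriv_eq ha (fun x hx => (H.hasDerivWithinAt i hx).1)
    (fun x hx => ?_) (fun x _ => abs_arm_le f i x) (by rw [arm_zero, h0]) hx
  rw [Real.sq_sqrt (by positivity)]
  exact (H.hasDerivWithinAt i hx).2

/-- The graph of the Laplace operator with Feller–Wentzell boundary condition. -/
theorem mem_graph_wentzellLaplacian [NeZero k] {α : ℝ} {β : Fin k → ℝ} {γ : ℝ}
    {m : Measure (StarGraph k)} {hm : ∫⁻ x, min 1 (radius x) ∂m < ∞} {f g : C(StarGraph k, ℝ)} :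
    (f, g) ∈ (wentzellLaplacian α β γ m hm).graph ↔ IsSecondDeriv f ((2 : ℝ) • g) ∧
      α * g center - ∑ i, β i * slope f i + γ * f center = ∫ x, (f x - f center) ∂m := by
  rw [LinearPMap.mem_graph_iff]
  constructor
  · rintro ⟨⟨y, hy⟩, rfl, hyg⟩
    obtain ⟨⟨hyC, hbc⟩, _⟩ := id hy
    have e : wentzellLaplacian α β γ m hm ⟨y, hy⟩ = (1 / 2 : ℝ) • secondDeriv k ⟨y, hyC⟩ := rfl
    have e2 : (2 : ℝ) • g = secondDeriv k ⟨y, hyC⟩ := by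
      have : g = (1 / 2 : ℝ) • secondDeriv k ⟨y, hyC⟩ := hyg.symm.trans e
      rw [this, smul_smul]; norm_num
    refine ⟨?_, ?_⟩
    · simp only [e2]
      exact secondDeriv_spec hyC
    · rw [← hbc, ← e2, ContinuousMap.smul_apply, smul_eq_mul]
      ring
  · rintro ⟨H, hbc⟩
    have hfC : f ∈ C2 k := ⟨_, H⟩
    have e2 : secondDeriv k ⟨f, hfC⟩ = (2 : ℝ) • g := (secondDeriv_spec hfC).unique H
    have hmem : f ∈ wentzellDomain α β γ m hm := by
      refine ⟨hfC, ?_⟩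
      rw [← hbc, e2, ContinuousMap.smul_apply, smul_eq_mul]
      ring
    refine ⟨⟨f, hmem, hfC⟩, rfl, ?_⟩
    have e : wentzellLaplacian α β γ m hm ⟨f, hmem, hfC⟩
      = (1 / 2 : ℝ) • secondDeriv k ⟨f, hfC⟩ := rfl
    rw [e, e2, smul_smul]; norm_num

/-! ### Density of the twice continuously differentiable functions -/

/-- The functions whose first two derivatives are continuous functions on the graph. -/
def smoothAlgebra (k : ℕ) : Subalgebra ℝ C(StarGraph k, ℝ) where
  carrier := {f | ∃ f₁ f₂ : C(StarGraph k, ℝ), ∀ i x, 0 ≤ x →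
    HasDerivWithinAt (arm f i) (arm f₁ i x) (Ici 0) x ∧
    HasDerivWithinAt (arm f₁ i) (arm f₂ i x) (Ici 0) x}
  mul_mem' := by
    rintro f g ⟨f₁, f₂, hf⟩ ⟨g₁, g₂, hg⟩
    refine ⟨f₁ * g + f * g₁, f₂ * g + f₁ * g₁ + (f₁ * g₁ + f * g₂), fun i x hx => ?_⟩
    obtain ⟨hf1, hf2⟩ := hf i x hx
    obtain ⟨hg1, hg2⟩ := hg i x hx
    exact ⟨hf1.mul hg1, (hf2.mul hg1).add (hf1.mul hg2)⟩
  add_mem' := by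
    rintro f g ⟨f₁, f₂, hf⟩ ⟨g₁, g₂, hg⟩
    exact ⟨f₁ + g₁, f₂ + g₂, fun i x hx =>
      ⟨(hf i x hx).1.add (hg i x hx).1, (hf i x hx).2.add (hg i x hx).2⟩⟩
  algebraMap_mem' c :=
    ⟨0, 0, fun i x _ => ⟨hasDerivWithinAt_const x _ c, hasDerivWithinAt_const x _ 0⟩⟩

theorem smoothAlgebra_le_C2 {f : C(StarGraph k, ℝ)} (hf : f ∈ smoothAlgebra k) : f ∈ C2 k := by
  obtain ⟨f₁, f₂, h⟩ := hf
  exact ⟨f₂, (isSecondDeriv_of_hasDerivWithinAt (f' := arm f₁) (fun i x hx => (h i x hx).1)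
    fun i x hx => (h i x hx).2).1⟩

/-- The cube makes the function and its first two derivatives vanish at the center, so that their
extensions by zero to the other edges are continuous; a square would fail at the second derivative.
-/
theorem exists_smooth_bump (i : Fin k) : ∃ f ∈ smoothAlgebra k, ∀ j x, f (edge j x)
    = if j = i then (if x = ∞ then 1 else (1 - Real.exp (-x.toReal)) ^ 3) else 0 := by
  have hexp : Tendsto (fun x : ℝ => Real.exp (-x)) atTop (𝓝 0) :=
    Real.tendsto_exp_neg_atTop_nhds_zero
  have mk : ∀ (φ : ℝ → ℝ) (L : ℝ), Continuous φ → Tendsto φ atTop (𝓝 L) → φ 0 = 0 →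
      ∃ f : C(StarGraph k, ℝ), ∀ j x, f (edge j x)
        = if j = i then (if x = ∞ then L else φ x.toReal) else 0 := by
    intro φ L hφ hL h0
    obtain ⟨f, hf⟩ := exists_of_arms (φ := fun j => if j = i then φ else 0)
      (L := fun j => if j = i then L else 0) (c := 0)
      (fun j => by split_ifs; exacts [hφ, continuous_const])
      (fun j => by split_ifs; exacts [hL, tendsto_const_nhds])
      (fun j => by split_ifs; exacts [h0, rfl])
    refine ⟨f, fun j x => ?_⟩
    rw [hf]
    split_ifs <;> rfl
  have harm : ∀ {f : C(StarGraph k, ℝ)} {φ : ℝ → ℝ} {L : ℝ}, (∀ j x, f (edge j x)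
        = if j = i then (if x = ∞ then L else φ x.toReal) else 0) → ∀ j x, 0 ≤ x →
        arm f j x = if j = i then φ x else 0 := by
    intro f φ L hf j x hx
    rw [arm, hf, if_neg ENNReal.ofReal_ne_top, ENNReal.toReal_ofReal hx]
  obtain ⟨f, hf⟩ := mk (fun x => (1 - Real.exp (-x)) ^ 3) 1 (by fun_prop)
    (by simpa using (hexp.const_sub 1).pow 3) (by simp)
  obtain ⟨f₁, hf₁⟩ := mk (fun x => 3 * (1 - Real.exp (-x)) ^ 2 * Real.exp (-x)) 0 (by fun_prop)
    (by simpa using (((hexp.const_sub 1).pow 2).const_mul 3).mul hexp) (by simp)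
  obtain ⟨f₂, hf₂⟩ := mk (fun x => 6 * (1 - Real.exp (-x)) * Real.exp (-x) * Real.exp (-x)
      - 3 * (1 - Real.exp (-x)) ^ 2 * Real.exp (-x)) 0 (by fun_prop)
    (by
      simpa using ((((hexp.const_sub 1).const_mul 6).mul hexp).mul hexp).sub
        ((((hexp.const_sub 1).pow 2).const_mul 3).mul hexp)) (by simp)
  refine ⟨f, ⟨f₁, f₂, fun j x hx => ?_⟩, hf⟩
  have hE : HasDerivAt (fun x : ℝ => Real.exp (-x)) (-Real.exp (-x)) x := by
    simpa using hasDerivAt_exp_const_mul (-1) x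
  have hE1 := hE.const_sub 1
  have a₀ := harm (φ := fun x => (1 - Real.exp (-x)) ^ 3) hf
  have a₁ := harm (φ := fun x => 3 * (1 - Real.exp (-x)) ^ 2 * Real.exp (-x)) hf₁
  have a₂ := harm (φ := fun x => 6 * (1 - Real.exp (-x)) * Real.exp (-x) * Real.exp (-x)
    - 3 * (1 - Real.exp (-x)) ^ 2 * Real.exp (-x)) hf₂
  rw [a₁ j x hx, a₂ j x hx]
  by_cases hj : j = i
  · simp only [hj, if_true]
    constructor
    · refine HasDerivWithinAt.congr ((hE1.pow 3).hasDerivWithinAt.congr_deriv ?_)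
        (fun y hy => by simpa using a₀ i y hy) (by simpa using a₀ i x hx)
      ring
    · refine HasDerivWithinAt.congr
        ((((hE1.pow 2).const_mul 3).mul hE).hasDerivWithinAt.congr_deriv ?_)
        (fun y hy => by simpa using a₁ i y hy) (by simpa using a₁ i x hx)
      simp only [Pi.pow_apply]
      ring
  · simp only [hj, if_false]
    exact ⟨(hasDerivWithinAt_const x _ 0).congr (fun y hy => by simpa [hj] using a₀ j y hy)
      (by simpa [hj] using a₀ j x hx),
      (hasDerivWithinAt_const x _ 0).congr (fun y hy => by simpa [hj] using a₁ j y hy)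
      (by simpa [hj] using a₁ j x hx)⟩

/-- The bump of an edge is injective along that edge and zero on the others: one bump separates
points of the same edge, and the two bumps together separate points of different edges unless both
are the center. -/
theorem smoothAlgebra_separatesPoints : (smoothAlgebra k).SeparatesPoints := by
  set θ : ℝ≥0∞ → ℝ := fun x => if x = ∞ then 1 else (1 - Real.exp (-x.toReal)) ^ 3 with hθ
  have hinj : Function.Injective θ := by
    have hlt : ∀ r : ℝ, (1 - Real.exp (-r)) ^ 3 ≠ 1 := fun r h => by
      have h3 : (1 - Real.exp (-r)) ^ 3 = 1 ^ 3 := by rw [h, one_pow]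
      have := (Odd.strictMono_pow (R := ℝ) (by decide : Odd 3)).injective h3
      linarith [Real.exp_pos (-r)]
    intro x y hxy
    simp only [hθ] at hxy
    split_ifs at hxy with hx hy hy
    · rw [hx, hy]
    · exact absurd hxy.symm (hlt _)
    · exact absurd hxy (hlt _)
    · have h1 := (Odd.strictMono_pow (R := ℝ) (by decide : Odd 3)).injective hxy
      have h2 : Real.exp (-x.toReal) = Real.exp (-y.toReal) := by linarith
      exact (ENNReal.toReal_eq_toReal_iff' hx hy).1 (neg_injective (Real.exp_injective h2))
  have hθ0 : θ 0 = 0 := by simp [hθ]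
  intro p q hpq
  by_contra hcon
  obtain ⟨i, x, rfl⟩ := exists_edge p
  obtain ⟨j, y, rfl⟩ := exists_edge q
  have key : ∀ f ∈ smoothAlgebra k, f (edge i x) = f (edge j y) := fun f hf => by
    by_contra hne
    exact hcon ⟨f, ⟨f, hf, rfl⟩, hne⟩
  obtain ⟨f, hf, hfi⟩ := exists_smooth_bump i
  obtain ⟨g, hg, hgj⟩ := exists_smooth_bump j
  have h1 := key f hf
  have h2 := key g hg
  rw [hfi, hfi] at h1
  rw [hgj, hgj] at h2
  simp only [if_true] at h1 h2
  by_cases hij : i = j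
  · subst hij
    simp only [if_true] at h1
    exact hpq (congrArg _ (hinj h1))
  · rw [if_neg (Ne.symm hij)] at h1
    rw [if_neg hij] at h2
    have hx : x = 0 := hinj (h1.trans hθ0.symm)
    have hy : y = 0 := hinj (h2.symm.trans hθ0.symm)
    exact hpq (Quotient.sound (Or.inr ⟨hx, hy⟩))

theorem dense_C2 : Dense (C2 k : Set C(StarGraph k, ℝ)) := by
  have h := ContinuousMap.subalgebra_topologicalClosure_eq_top_of_separatesPoints
    (smoothAlgebra k) smoothAlgebra_separatesPoints
  have hd : Dense (smoothAlgebra k : Set C(StarGraph k, ℝ)) := by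
    intro f
    have : f ∈ (smoothAlgebra k).topologicalClosure := h ▸ Algebra.mem_top
    exact this
  exact hd.mono fun f hf => smoothAlgebra_le_C2 hf

end StarGraph

namespace StarGraph

variable {k : ℕ} {lam : ℝ}

theorem sqrt_two_mul_pos (hl : 0 < lam) : 0 < √(2 * lam) := Real.sqrt_pos.2 (by positivity)

theorem sq_sqrt_two_mul (hl : 0 < lam) : √(2 * lam) ^ 2 = 2 * lam := Real.sq_sqrt (by positivity)

/-! ### The function `l⁰_lam` -/

theorem minimalLifetime_edge (i : Fin k) (x : ℝ≥0∞) : minimalLifetime lam (edge i x)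
    = if x = ∞ then 0 else Real.exp (-√(2 * lam) * x.toReal) := rfl

theorem minimalLifetime_center [NeZero k] : minimalLifetime lam (center : StarGraph k) = 1 := by
  simp [minimalLifetime]

theorem minimalLifetime_nonneg (p : StarGraph k) : 0 ≤ minimalLifetime lam p := by
  rw [minimalLifetime]; split_ifs <;> positivity

theorem minimalLifetime_le_one (p : StarGraph k) : minimalLifetime lam p ≤ 1 := by
  rw [minimalLifetime]
  split_ifs
  · exact zero_le_one
  · refine Real.exp_le_one_iff.2 ?_
    have := mul_nonneg (Real.sqrt_nonneg (2 * lam)) (ENNReal.toReal_nonneg (a := radius p))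
    linarith

theorem minimalLifetime_lt_one (hl : 0 < lam) {p : StarGraph k} (hp : radius p ≠ 0) :
    minimalLifetime lam p < 1 := by
  rw [minimalLifetime]
  split_ifs with h
  · exact zero_lt_one
  · refine Real.exp_lt_one_iff.2 ?_
    have := mul_pos (sqrt_two_mul_pos hl) (ENNReal.toReal_pos hp h)
    linarith

theorem continuous_minimalLifetime (hl : 0 < lam) :
    Continuous (minimalLifetime lam : StarGraph k → ℝ) := by
  have ha := sqrt_two_mul_pos hl
  obtain ⟨f, hf⟩ := exists_of_arms (k := k) (φ := fun _ x => Real.exp (-√(2 * lam) * x))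
    (L := fun _ => 0) (c := 1) (fun _ => by fun_prop)
    (fun _ => Real.tendsto_exp_atBot.comp (tendsto_id.const_mul_atTop_of_neg (by linarith)))
    (fun _ => by simp)
  have : minimalLifetime lam = f := by
    ext p
    obtain ⟨i, x, rfl⟩ := exists_edge p
    rw [hf, minimalLifetime_edge]
  rw [this]
  exact f.continuous

/-- The function `l⁰_lam` as an element of `C(S)`. -/
def lifetimeMap (hl : 0 < lam) : C(StarGraph k, ℝ) :=
  ⟨minimalLifetime lam, continuous_minimalLifetime hl⟩

theorem lifetimeMap_apply (hl : 0 < lam) (p : StarGraph k) :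
    lifetimeMap hl p = minimalLifetime lam p := rfl

theorem lifetimeMap_center [NeZero k] (hl : 0 < lam) :
    lifetimeMap hl (center : StarGraph k) = 1 := minimalLifetime_center

theorem norm_lifetimeMap_le (hl : 0 < lam) : ‖(lifetimeMap hl : C(StarGraph k, ℝ))‖ ≤ 1 := by
  refine (ContinuousMap.norm_le _ zero_le_one).2 fun p => ?_
  rw [lifetimeMap_apply, Real.norm_of_nonneg (minimalLifetime_nonneg p)]
  exact minimalLifetime_le_one p

theorem lifetimeMap_isSecondDeriv (hl : 0 < lam) :
    IsSecondDeriv (lifetimeMap hl : C(StarGraph k, ℝ)) ((2 * lam) • lifetimeMap hl) ∧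
      ∀ i : Fin k, slope (lifetimeMap hl) i = -√(2 * lam) := by
  have e : ∀ (i : Fin k) x, 0 ≤ x → arm (lifetimeMap hl) i x = Real.exp (-√(2 * lam) * x) :=
    fun i x hx => arm_eq_of_edge (φ := fun x => Real.exp (-√(2 * lam) * x))
      (fun x => minimalLifetime_edge i x) hx
  have := isSecondDeriv_of_hasDerivWithinAt (f := (lifetimeMap hl : C(StarGraph k, ℝ)))
    (h := (2 * lam) • lifetimeMap hl)
    (f' := fun _ x => -√(2 * lam) * Real.exp (-√(2 * lam) * x))
    (fun i x hx => (hasDerivAt_exp_const_mul _ x).hasDerivWithinAt.congr (fun y hy => e i y hy)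
      (e i x hx))
    (fun i x hx => by
      rw [arm_smul, Pi.smul_apply, e i x hx, smul_eq_mul]
      refine ((hasDerivAt_exp_const_mul _ x).const_mul (-√(2 * lam))).hasDerivWithinAt.congr_deriv
        ?_
      linear_combination Real.exp (-√(2 * lam) * x) * sq_sqrt_two_mul hl)
  refine ⟨this.1, fun i => ?_⟩
  rw [this.2]; simp

/-! ### The resolvent of the minimal Brownian motion -/

theorem minimalResolvent_edge (g : C(StarGraph k, ℝ)) (i : Fin k) (x : ℝ≥0∞) :
    minimalResolvent lam g (edge i x)
      = if x = ∞ then g (edge i ∞) / lam else minimalResolventArm lam g i x.toReal := rfl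

theorem minimalResolventArm_eq (hl : 0 < lam) (g : C(StarGraph k, ℝ)) (i : Fin k) {x : ℝ}
    (hx : 0 ≤ x) : minimalResolventArm lam g i x = halfLinePotential √(2 * lam) (arm g i) x :=
  integral_killedKernel_mul (sqrt_two_mul_pos hl) (continuous_arm g i) (abs_arm_le g i) hx

theorem minimalResolvent_edge_eq (hl : 0 < lam) (g : C(StarGraph k, ℝ)) (i : Fin k) (x : ℝ≥0∞) :
    minimalResolvent lam g (edge i x)
      = if x = ∞ then g (edge i ∞) / lam
        else halfLinePotential √(2 * lam) (arm g i) x.toReal := by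
  rw [minimalResolvent_edge, minimalResolventArm_eq hl g i ENNReal.toReal_nonneg]

theorem continuous_minimalResolvent (hl : 0 < lam) (g : C(StarGraph k, ℝ)) :
    Continuous (minimalResolvent lam g) := by
  have ha := sqrt_two_mul_pos hl
  obtain ⟨f, hf⟩ := exists_of_arms (φ := fun i => halfLinePotential √(2 * lam) (arm g i))
    (L := fun i => g (edge i ∞) / lam) (c := 0)
    (fun i => continuous_iff_continuousAt.2 fun x =>
      (hasDerivAt_halfLinePotential ha.ne' (continuous_arm g i) x).continuousAt)
    (fun i => by
      have := tendsto_halfLinePotential ha (continuous_arm g i) (abs_arm_le g i) (tendsto_arm g i)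
      rw [sq_sqrt_two_mul hl] at this
      convert this using 2
      field_simp)
    (fun i => halfLinePotential_zero)
  have : minimalResolvent lam g = f := by
    ext p
    obtain ⟨i, x, rfl⟩ := exists_edge p
    rw [hf, minimalResolvent_edge_eq hl]
  rw [this]
  exact f.continuous

/-- The function `R⁰_lam g` as an element of `C(S)`. -/
def resolventMap (hl : 0 < lam) (g : C(StarGraph k, ℝ)) : C(StarGraph k, ℝ) :=
  ⟨minimalResolvent lam g, continuous_minimalResolvent hl g⟩

theorem resolventMap_apply (hl : 0 < lam) (g : C(StarGraph k, ℝ)) (p : StarGraph k) :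
    resolventMap hl g p = minimalResolvent lam g p := rfl

theorem minimalResolvent_center [NeZero k] (g : C(StarGraph k, ℝ)) :
    minimalResolvent lam g center = 0 := by
  rw [center, minimalResolvent_edge, if_neg ENNReal.zero_ne_top, ENNReal.toReal_zero,
    minimalResolventArm_zero]

theorem resolventMap_isSecondDeriv (hl : 0 < lam) (g : C(StarGraph k, ℝ)) :
    IsSecondDeriv (resolventMap hl g) ((2 * lam) • resolventMap hl g - (2 : ℝ) • g) ∧
      ∀ i, slope (resolventMap hl g) i = 2 * √(2 * lam) * edgeCoeff lam g i := by
  have ha := sqrt_two_mul_pos hl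
  have e : ∀ (i : Fin k) x, 0 ≤ x →
      arm (resolventMap hl g) i x = halfLinePotential √(2 * lam) (arm g i) x :=
    fun i x hx => arm_eq_of_edge (fun x => minimalResolvent_edge_eq hl g i x) hx
  have := isSecondDeriv_of_hasDerivWithinAt (f := resolventMap hl g)
    (h := (2 * lam) • resolventMap hl g - (2 : ℝ) • g)
    (f' := fun i => halfLinePotentialDeriv √(2 * lam) (arm g i))
    (fun i x hx => (hasDerivAt_halfLinePotential ha.ne' (continuous_arm g i)
      x).hasDerivWithinAt.congr (fun y hy => e i y hy) (e i x hx))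
    (fun i x hx => by
      refine (hasDerivAt_halfLinePotentialDeriv ha.ne' (continuous_arm g i)
        x).hasDerivWithinAt.congr_deriv ?_
      rw [← e i x hx, sq_sqrt_two_mul hl]
      rfl)
  refine ⟨this.1, fun i => ?_⟩
  rw [this.2, halfLinePotentialDeriv_zero, edgeCoeff]
  field_simp

theorem resolventMap_mem_C2 (hl : 0 < lam) (g : C(StarGraph k, ℝ)) : resolventMap hl g ∈ C2 k :=
  ⟨_, (resolventMap_isSecondDeriv hl g).1⟩

/-- The identity behind the contraction estimate and behind the explicit form of the denominator. -/
theorem minimalResolvent_one (hl : 0 < lam) (p : StarGraph k) :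
    minimalResolvent lam 1 p = lam⁻¹ * (1 - minimalLifetime lam p) := by
  obtain ⟨i, x, rfl⟩ := exists_edge p
  rw [minimalResolvent_edge_eq hl, minimalLifetime_edge]
  split_ifs
  · simp
  · have : arm (1 : C(StarGraph k, ℝ)) i = 1 := rfl
    rw [this, halfLinePotential_one (sqrt_two_mul_pos hl), sq_sqrt_two_mul hl]
    field_simp

theorem minimalResolvent_nonneg (hl : 0 < lam) {g : C(StarGraph k, ℝ)} (hg : 0 ≤ g)
    (p : StarGraph k) : 0 ≤ minimalResolvent lam g p := by
  obtain ⟨i, x, rfl⟩ := exists_edge p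
  rw [minimalResolvent_edge]
  split_ifs
  · exact div_nonneg (hg _) hl.le
  · refine mul_nonneg (by positivity) (setIntegral_nonneg measurableSet_Ioi fun y hy => ?_)
    exact mul_nonneg (killedKernel_nonneg (sqrt_two_mul_pos hl) ENNReal.toReal_nonneg
      (mem_Ioi.1 hy).le) (hg _)

theorem abs_minimalResolvent_le (hl : 0 < lam) (g : C(StarGraph k, ℝ)) (p : StarGraph k) :
    |minimalResolvent lam g p| ≤ ‖g‖ * minimalResolvent lam 1 p := by
  have ha := sqrt_two_mul_pos hl
  obtain ⟨i, x, rfl⟩ := exists_edge p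
  rw [minimalResolvent_edge, minimalResolvent_edge]
  split_ifs
  · rw [abs_div, abs_of_pos hl, mul_div_assoc', ContinuousMap.one_apply, mul_one]
    gcongr
    exact g.norm_coe_le_norm _
  · rw [minimalResolventArm, minimalResolventArm, abs_mul, abs_of_nonneg (by positivity),
      mul_left_comm]
    gcongr
    rw [← integral_const_mul, ← Real.norm_eq_abs]
    refine norm_integral_le_of_norm_le ((integrableOn_killedKernel_mul ha (continuous_arm 1 i)
      (abs_arm_le 1 i) x.toReal).const_mul ‖g‖) ?_
    filter_upwards [self_mem_ae_restrict measurableSet_Ioi] with y hy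
    have hk := killedKernel_nonneg ha (x := x.toReal) ENNReal.toReal_nonneg (mem_Ioi.1 hy).le
    rw [norm_mul, Real.norm_of_nonneg hk, mul_left_comm]
    refine mul_le_mul_of_nonneg_left ?_ hk
    rw [arm, arm, ContinuousMap.one_apply, mul_one]
    exact g.norm_coe_le_norm _

/-! ### The coefficients -/

theorem edgeCoeff_one (hl : 0 < lam) (i : Fin k) : edgeCoeff lam 1 i = (2 * lam)⁻¹ := by
  have ha := sqrt_two_mul_pos hl
  have : arm (1 : C(StarGraph k, ℝ)) i = fun _ => 1 := rfl
  have h2 := sq_sqrt_two_mul hl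
  rw [edgeCoeff, this]
  simp only [mul_one]
  rw [integral_exp_mul_Ioi (by linarith), mul_zero, Real.exp_zero, ← h2, Real.sqrt_sq ha.le]
  field_simp

theorem edgeCoeff_nonneg {g : C(StarGraph k, ℝ)} (hg : 0 ≤ g) (i : Fin k) :
    0 ≤ edgeCoeff lam g i :=
  mul_nonneg (by positivity) (setIntegral_nonneg measurableSet_Ioi fun _ _ =>
    mul_nonneg (Real.exp_pos _).le (hg _))

theorem abs_edgeCoeff_le (hl : 0 < lam) (g : C(StarGraph k, ℝ)) (i : Fin k) :
    |edgeCoeff lam g i| ≤ ‖g‖ * edgeCoeff lam 1 i := by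
  have ha := sqrt_two_mul_pos hl
  rw [edgeCoeff, edgeCoeff, abs_mul, abs_of_nonneg (by positivity), mul_left_comm]
  gcongr
  rw [← integral_const_mul, ← Real.norm_eq_abs]
  refine norm_integral_le_of_norm_le ((integrableOn_exp_neg_mul_mul ha (continuous_arm 1 i)
      (abs_arm_le 1 i) 0).const_mul ‖g‖) (.of_forall fun y => ?_)
  rw [norm_mul, Real.norm_of_nonneg (Real.exp_pos _).le, mul_left_comm]
  refine mul_le_mul_of_nonneg_left ?_ (Real.exp_pos _).le
  rw [arm, arm, ContinuousMap.one_apply, mul_one]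
  exact g.norm_coe_le_norm _

variable [NeZero k] {α γ : ℝ} {β : Fin k → ℝ} {m : Measure (StarGraph k)}

theorem coeff_one (hl : 0 < lam) :
    lam * coeff α β lam 1 = √(2 * lam) * ∑ i, β i + lam * α := by
  simp only [coeff, edgeCoeff_one hl, ContinuousMap.one_apply, ← Finset.sum_mul]
  field_simp

theorem coeff_nonneg (hα : 0 ≤ α) (hβ : ∀ i, 0 ≤ β i) {g : C(StarGraph k, ℝ)} (hg : 0 ≤ g) :
    0 ≤ coeff α β lam g :=
  add_nonneg (mul_nonneg (by positivity) (Finset.sum_nonneg fun i _ =>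
    mul_nonneg (hβ i) (edgeCoeff_nonneg hg i))) (mul_nonneg hα (hg _))

theorem abs_coeff_le (hl : 0 < lam) (hα : 0 ≤ α) (hβ : ∀ i, 0 ≤ β i) (g : C(StarGraph k, ℝ)) :
    |coeff α β lam g| ≤ ‖g‖ * coeff α β lam 1 := by
  rw [coeff, coeff, mul_add]
  refine (abs_add_le _ _).trans (add_le_add ?_ ?_)
  · rw [abs_mul, abs_of_nonneg (by positivity), mul_left_comm]
    refine mul_le_mul_of_nonneg_left ?_ (by positivity)
    rw [Finset.mul_sum]
    refine (Finset.abs_sum_le_sum_abs _ _).trans (Finset.sum_le_sum fun i _ => ?_)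
    rw [abs_mul, abs_of_nonneg (hβ i), mul_left_comm]
    exact mul_le_mul_of_nonneg_left (abs_edgeCoeff_le hl g i) (hβ i)
  · rw [abs_mul, abs_of_nonneg hα, ContinuousMap.one_apply, mul_one, mul_comm ‖g‖]
    exact mul_le_mul_of_nonneg_left (g.norm_coe_le_norm _) hα

section Integrable

variable (hm : ∫⁻ x, min 1 (radius x) ∂m < ∞)
include hm

theorem integrable_minimalResolvent (hl : 0 < lam) (g : C(StarGraph k, ℝ)) :
    Integrable (minimalResolvent lam g) m := by
  have := integrable_sub_center hm (resolventMap_mem_C2 hl g)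
  simpa only [resolventMap_apply, minimalResolvent_center, sub_zero] using this

theorem integrable_one_sub_minimalLifetime (hl : 0 < lam) :
    Integrable (fun p => 1 - minimalLifetime lam p) m := by
  refine ((integrable_minimalResolvent hm hl 1).const_mul lam).congr (.of_forall fun p => ?_)
  simp only [minimalResolvent_one hl]
  field_simp

omit hm in
-- In this form the denominator is minus the boundary functional at `ℓ⁰`, whose slopes are `-√(2
-- lam)` and whose Laplacian at the center is `lam`. All summands are nonnegative for nonnegative
-- parameters, so each one is a lower bound.
theorem coeffBarDenom_eq (hl : 0 < lam) : coeffBarDenom α β γ m lam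
    = γ + ∫ p, (1 - minimalLifetime lam p) ∂m + (√(2 * lam) * ∑ i, β i + lam * α) := by
  rw [coeffBarDenom, coeff_one hl, ← integral_const_mul]
  congr 2
  refine integral_congr_ae (.of_forall fun p => ?_)
  simp only [minimalResolvent_one hl]
  field_simp

theorem abs_integral_minimalResolvent_le (hl : 0 < lam) (g : C(StarGraph k, ℝ)) :
    |∫ p, minimalResolvent lam g p ∂m| ≤ ‖g‖ * ∫ p, minimalResolvent lam 1 p ∂m := by
  rw [← integral_const_mul, ← Real.norm_eq_abs]
  exact norm_integral_le_of_norm_le ((integrable_minimalResolvent hm hl 1).const_mul _)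
    (.of_forall fun p => abs_minimalResolvent_le hl g p)

/-- The numerator is at most `‖g‖` times its value at `g = 1`, and the denominator is `lam` times
that value plus `γ ≥ 0`. -/
theorem abs_coeffBar_le (hl : 0 < lam) (hα : 0 ≤ α) (hβ : ∀ i, 0 ≤ β i) (hγ : 0 ≤ γ)
    (hD : 0 < coeffBarDenom α β γ m lam) (g : C(StarGraph k, ℝ)) :
    |coeffBar α β γ m lam g| ≤ lam⁻¹ * ‖g‖ := by
  rw [coeffBar, abs_div, abs_of_pos hD, div_le_iff₀ hD, coeffBarDenom]
  have h1 := abs_integral_minimalResolvent_le hm hl g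
  have h2 := abs_coeff_le hl hα hβ g
  refine (abs_add_le _ _).trans ((add_le_add h1 h2).trans ?_)
  have h3 : 0 ≤ lam⁻¹ * ‖g‖ * γ := by positivity
  have h4 : lam⁻¹ * lam = 1 := inv_mul_cancel₀ hl.ne'
  have h5 : lam⁻¹ * ‖g‖ * (γ + lam * ∫ p, minimalResolvent lam 1 p ∂m + lam * coeff α β lam 1)
      = lam⁻¹ * ‖g‖ * γ + (lam⁻¹ * lam) * (‖g‖ * ∫ p, minimalResolvent lam 1 p ∂m
        + ‖g‖ * coeff α β lam 1) := by ring
  rw [h5, h4]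
  linarith

omit hm in
theorem coeffBar_nonneg (hl : 0 < lam) (hα : 0 ≤ α) (hβ : ∀ i, 0 ≤ β i)
    (hD : 0 < coeffBarDenom α β γ m lam) {g : C(StarGraph k, ℝ)} (hg : 0 ≤ g) :
    0 ≤ coeffBar α β γ m lam g :=
  div_nonneg (add_nonneg (integral_nonneg fun p => minimalResolvent_nonneg hl hg p)
    (coeff_nonneg hα hβ hg)) hD.le

/-- Adding a multiple of `l⁰_lam` to a function in `C²(S)` to satisfy the boundary condition. -/
theorem add_smul_lifetimeMap_mem_graph_iff (hl : 0 < lam) {f h : C(StarGraph k, ℝ)}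
    (H : IsSecondDeriv f ((2 : ℝ) • h)) (c : ℝ) :
    (f + c • lifetimeMap hl, h + (lam * c) • lifetimeMap hl) ∈ (wentzellLaplacian α β γ m hm).graph
      ↔ c * coeffBarDenom α β γ m lam
        = ∫ p, (f p - f center) ∂m - α * h center + ∑ i, β i * slope f i - γ * f center := by
  have Hl := ((lifetimeMap_isSecondDeriv (k := k) hl).1.smul c)
  have HH : IsSecondDeriv (f + c • lifetimeMap hl) ((2 : ℝ) • (h + (lam * c) • lifetimeMap hl)) := by
    convert H.add Hl using 1
    rw [smul_add, smul_smul, smul_smul]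
    congr 2
    ring
  have hs : ∀ i, slope (f + c • lifetimeMap hl) i = slope f i - c * √(2 * lam) := fun i => by
    rw [H.slope_add Hl, slope_smul c ⟨_, (lifetimeMap_isSecondDeriv hl).1⟩,
      (lifetimeMap_isSecondDeriv hl).2]
    ring
  have hint : ∫ p, ((f + c • lifetimeMap hl : C(StarGraph k, ℝ)) p
      - (f + c • lifetimeMap hl : C(StarGraph k, ℝ)) center) ∂m
      = ∫ p, (f p - f center) ∂m - c * ∫ p, (1 - minimalLifetime lam p) ∂m := by
    rw [← integral_const_mul, ← integral_sub (integrable_sub_center hm ⟨_, H⟩)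
      ((integrable_one_sub_minimalLifetime hm hl).const_mul c)]
    refine integral_congr_ae (.of_forall fun p => ?_)
    simp only [ContinuousMap.add_apply, ContinuousMap.smul_apply, smul_eq_mul, lifetimeMap_apply,
      minimalLifetime_center]
    ring
  rw [mem_graph_wentzellLaplacian, and_iff_right HH, hint, coeffBarDenom_eq hl]
  simp only [hs, ContinuousMap.add_apply, ContinuousMap.smul_apply, lifetimeMap_center, smul_eq_mul,
    mul_sub, Finset.sum_sub_distrib, ← Finset.sum_mul]
  constructor <;> intro hh <;> linear_combination hh

end Integrable

end StarGraph

namespace StarGraph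

variable {k : ℕ} [NeZero k] {α γ : ℝ} {β : Fin k → ℝ} {m : Measure (StarGraph k)}

/-! ### The Laplace operator with Feller–Wentzell boundary condition is a generator -/

theorem dense_domain_wentzellLaplacian {hm : ∫⁻ x, min 1 (radius x) ∂m < ∞}
    (hD : ∀ C : ℝ, ∃ lam : ℝ, 0 < lam ∧ C ≤ coeffBarDenom α β γ m lam) :
    Dense {f | ∃ h, (f, h) ∈ (wentzellLaplacian α β γ m hm).graph} := by
  refine Dense.of_closure (dense_C2.mono ?_)
  rintro f ⟨h, H⟩
  have H' : IsSecondDeriv f ((2 : ℝ) • (1 / 2 : ℝ) • h) := by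
    rw [smul_smul]; norm_num [H]
  rw [Metric.mem_closure_iff]
  intro ε hε
  set b := ∫ p, (f p - f center) ∂m - α * ((1 / 2 : ℝ) • h) center + ∑ i, β i * slope f i
    - γ * f center with hb
  -- The correction has norm at most `|b|` over the denominator, hence less than `ε`; the added `1`
  -- keeps the bound positive when `b = 0`.
  obtain ⟨lam, hl, hlD⟩ := hD ((|b| + 1) / ε)
  have hpos : 0 < coeffBarDenom α β γ m lam := lt_of_lt_of_le (by positivity) hlD
  refine ⟨f + (b / coeffBarDenom α β γ m lam) • lifetimeMap hl, ⟨_,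
    (add_smul_lifetimeMap_mem_graph_iff hm hl H' _).2 (div_mul_cancel₀ b hpos.ne')⟩, ?_⟩
  rw [dist_eq_norm, sub_add_cancel_left, norm_neg, norm_smul, norm_div, Real.norm_eq_abs,
    Real.norm_of_nonneg hpos.le]
  rw [div_le_iff₀ hε] at hlD
  calc _ ≤ |b| / coeffBarDenom α β γ m lam * 1 := by
        gcongr
        exact norm_lifetimeMap_le hl
    _ < ε := by
        rw [mul_one, div_lt_iff₀ hpos]
        linarith

/-- `R⁰ g` solves the equation and vanishes at the center, so its Laplacian there is `-g(0)`; with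
its slopes the boundary functional becomes exactly the numerator of `C̄(g)`. -/
theorem mem_graph_resolvent (hm : ∫⁻ x, min 1 (radius x) ∂m < ∞) {lam : ℝ} (hl : 0 < lam)
    (hD : coeffBarDenom α β γ m lam ≠ 0) (g : C(StarGraph k, ℝ)) :
    (resolventMap hl g + coeffBar α β γ m lam g • lifetimeMap hl,
      lam • (resolventMap hl g + coeffBar α β γ m lam g • lifetimeMap hl) - g)
      ∈ (wentzellLaplacian α β γ m hm).graph := by
  have H : IsSecondDeriv (resolventMap hl g) ((2 : ℝ) • (lam • resolventMap hl g - g)) := by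
    convert (resolventMap_isSecondDeriv hl g).1 using 1
    rw [smul_sub, smul_smul]
  have h := (add_smul_lifetimeMap_mem_graph_iff (α := α) (β := β) (γ := γ) hm hl H
    (coeffBar α β γ m lam g)).2 (by
      rw [coeffBar, div_mul_cancel₀ _ hD, coeff, Finset.mul_sum]
      simp only [(resolventMap_isSecondDeriv hl g).2, resolventMap_apply, minimalResolvent_center,
        ContinuousMap.sub_apply, ContinuousMap.smul_apply, smul_eq_mul, sub_zero, mul_zero,
        zero_sub, mul_neg, sub_neg_eq_add]
      rw [add_assoc, add_comm (α * _)]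
      congr 2
      exact Finset.sum_congr rfl fun i _ => by ring)
  convert h using 2
  rw [smul_add, smul_smul]
  abel

theorem eq_zero_of_mem_graph (hm : ∫⁻ x, min 1 (radius x) ∂m < ∞) {lam : ℝ} (hl : 0 < lam)
    (hD : coeffBarDenom α β γ m lam ≠ 0) {f : C(StarGraph k, ℝ)}
    (hf : (f, lam • f) ∈ (wentzellLaplacian α β γ m hm).graph) : f = 0 := by
  have H := (mem_graph_wentzellLaplacian.1 hf).1
  -- Subtracting `f(0) ℓ⁰` gives an eigenfunction that vanishes at the center, hence zero. Thus `f =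
  -- f(0) ℓ⁰`, and the boundary condition reads `f(0) * D(lam) = 0`.
  have Hw : IsSecondDeriv (f + (-f center) • lifetimeMap hl)
      ((2 * lam) • (f + (-f center) • lifetimeMap hl)) := by
    convert H.add ((lifetimeMap_isSecondDeriv hl).1.smul (-f center)) using 1
    module
  have hw := Hw.eq_zero hl (by
    rw [ContinuousMap.add_apply, ContinuousMap.smul_apply, lifetimeMap_center]
    simp)
  have e : f = 0 + f center • lifetimeMap hl := by
    rw [neg_smul, ← sub_eq_add_neg, sub_eq_zero] at hw
    rw [zero_add]
    exact hw
  have e2 : lam • f = 0 + (lam * f center) • lifetimeMap hl := by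
    rw [zero_add, mul_smul]
    rw [zero_add] at e
    exact congrArg (lam • ·) e
  have hs : ∀ i, slope (0 : C(StarGraph k, ℝ)) i = 0 := fun i => by
    simpa using slope_smul 0 (C2 k).zero_mem i
  have h0 : IsSecondDeriv (0 : C(StarGraph k, ℝ)) ((2 : ℝ) • 0) := by
    rw [smul_zero]; exact IsSecondDeriv.zero
  rw [e2] at hf
  have hf' : (0 + f center • lifetimeMap hl, 0 + (lam * f center) • lifetimeMap hl)
      ∈ (wentzellLaplacian α β γ m hm).graph := by
    rw [← e]; exact hf
  have hc := (add_smul_lifetimeMap_mem_graph_iff hm hl h0 (f center)).1 hf'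
  simp only [hs, ContinuousMap.zero_apply, sub_self, integral_zero, mul_zero,
    Finset.sum_const_zero, add_zero] at hc
  rw [e, (mul_eq_zero.1 hc).resolve_right hD, zero_smul, add_zero]

/-- The resolvent of the Laplace operator with Feller–Wentzell boundary condition. -/
theorem exists_resolvent_wentzellLaplacian (hα : 0 ≤ α) (hγ : 0 ≤ γ) (hβ : ∀ i, 0 ≤ β i)
    (hm : ∫⁻ x, min 1 (radius x) ∂m < ∞)
    (hpos : ∀ lam : ℝ, 0 < lam → 0 < coeffBarDenom α β γ m lam)
    (hD : ∀ C : ℝ, ∃ lam : ℝ, 0 < lam ∧ C ≤ coeffBarDenom α β γ m lam) :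
    ∃ R, HasContractionResolvent (wentzellLaplacian α β γ m hm) R ∧
      ∀ lam, 0 < lam → ∀ g p, R lam g p
        = minimalResolvent lam g p + coeffBar α β γ m lam g * minimalLifetime lam p := by
  have hinj : ∀ lam : ℝ, 0 < lam → ∀ f, (f, lam • f) ∈ (wentzellLaplacian α β γ m hm).graph →
      f = 0 := fun lam hl f hf => eq_zero_of_mem_graph hm hl (hpos lam hl).ne' hf
  obtain ⟨R, HR⟩ := exists_hasContractionResolvent (dense_domain_wentzellLaplacian (hm := hm) hD)
    (fun lam hl g => ⟨_, mem_graph_resolvent hm hl (hpos lam hl).ne' g, by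
      refine (ContinuousMap.norm_le _ (by positivity)).2 fun p => ?_
      -- The two summands are bounded by `lam⁻¹ * ‖g‖` times `1 - ℓ⁰` and `ℓ⁰`, weights with sum
      -- one.
      have h1 := abs_minimalResolvent_le hl g p
      have h2 := abs_coeffBar_le hm hl hα hβ hγ (hpos lam hl) g
      rw [minimalResolvent_one hl] at h1
      have h3 := minimalLifetime_nonneg (lam := lam) p
      have h4 := mul_le_mul_of_nonneg_right h2 h3
      rw [ContinuousMap.add_apply, ContinuousMap.smul_apply, smul_eq_mul, resolventMap_apply,
        lifetimeMap_apply, Real.norm_eq_abs]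
      refine (abs_add_le _ _).trans ?_
      rw [abs_mul, abs_of_nonneg h3]
      linarith⟩) hinj
  refine ⟨R, HR, fun lam hl g p => ?_⟩
  have h1 := HR.left_inv lam hl _ _ (mem_graph_resolvent hm hl (hpos lam hl).ne' g)
  rw [sub_sub_cancel] at h1
  rw [h1]
  rfl

theorem isFellerGenerator_wentzellLaplacian (hα : 0 ≤ α) (hγ : 0 ≤ γ) (hβ : ∀ i, 0 ≤ β i)
    (hm : ∫⁻ x, min 1 (radius x) ∂m < ∞)
    (hpos : ∀ lam : ℝ, 0 < lam → 0 < coeffBarDenom α β γ m lam)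
    (hD : ∀ C : ℝ, ∃ lam : ℝ, 0 < lam ∧ C ≤ coeffBarDenom α β γ m lam) :
    IsFellerGenerator (wentzellLaplacian α β γ m hm) := by
  obtain ⟨R, HR, hR⟩ := exists_resolvent_wentzellLaplacian hα hγ hβ hm hpos hD
  refine HR.isFellerGenerator fun lam hl g hg p => ?_
  change 0 ≤ R lam g p
  rw [hR lam hl]
  exact add_nonneg (minimalResolvent_nonneg hl hg p)
    (mul_nonneg (coeffBar_nonneg hl hα hβ (hpos lam hl) hg) (minimalLifetime_nonneg p))

/-! ### The denominator of `C̄` -/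

omit [NeZero k] in
theorem integral_one_sub_minimalLifetime_nonneg (lam : ℝ) :
    0 ≤ ∫ p, (1 - minimalLifetime lam p) ∂m :=
  integral_nonneg fun p => sub_nonneg.2 (minimalLifetime_le_one p)

theorem sqrt_mul_le_coeffBarDenom (hα : 0 ≤ α) (hγ : 0 ≤ γ) (hβ : ∀ i, 0 ≤ β i) {lam : ℝ}
    (hl : 0 < lam) (i : Fin k) : √(2 * lam) * β i ≤ coeffBarDenom α β γ m lam := by
  rw [coeffBarDenom_eq hl]
  have h1 := integral_one_sub_minimalLifetime_nonneg (m := m) lam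
  have h2 : √(2 * lam) * β i ≤ √(2 * lam) * ∑ i, β i :=
    mul_le_mul_of_nonneg_left (Finset.single_le_sum (fun i _ => hβ i) (Finset.mem_univ i))
      (Real.sqrt_nonneg _)
  have h3 := mul_nonneg hl.le hα
  linarith

theorem integral_le_coeffBarDenom (hα : 0 ≤ α) (hγ : 0 ≤ γ) (hβ : ∀ i, 0 ≤ β i) {lam : ℝ}
    (hl : 0 < lam) : ∫ p, (1 - minimalLifetime lam p) ∂m ≤ coeffBarDenom α β γ m lam := by
  rw [coeffBarDenom_eq hl]
  have h2 : 0 ≤ √(2 * lam) * ∑ i, β i :=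
    mul_nonneg (Real.sqrt_nonneg _) (Finset.sum_nonneg fun i _ => hβ i)
  have h3 := mul_nonneg hl.le hα
  linarith

theorem coeffBarDenom_pos_of_pos (hα : 0 ≤ α) (hγ : 0 ≤ γ) (hβ : ∀ i, 0 < β i) {lam : ℝ}
    (hl : 0 < lam) : 0 < coeffBarDenom α β γ m lam :=
  (mul_pos (sqrt_two_mul_pos hl) (hβ 0)).trans_le
    (sqrt_mul_le_coeffBarDenom hα hγ (fun i => (hβ i).le) hl 0)

theorem coeffBarDenom_unbounded_of_pos (hα : 0 ≤ α) (hγ : 0 ≤ γ) (hβ : ∀ i, 0 < β i) (C : ℝ) :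
    ∃ lam : ℝ, 0 < lam ∧ C ≤ coeffBarDenom α β γ m lam := by
  -- With `lam = r ^ 2 / 2` one has `√(2 lam) = r`, so a single edge contributes `r * β 0 = |C| +
  -- 1`.
  set r := (|C| + 1) / β 0 with hr
  have hr0 : 0 < r := div_pos (by positivity) (hβ 0)
  refine ⟨r ^ 2 / 2, by positivity, le_trans ?_
    (sqrt_mul_le_coeffBarDenom hα hγ (fun i => (hβ i).le) (by positivity) 0)⟩
  rw [mul_div_cancel₀ _ two_ne_zero, Real.sqrt_sq hr0.le, hr, div_mul_cancel₀ _ (hβ 0).ne']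
  linarith [le_abs_self C]

/-! ### The denominator for an infinite measure -/

section Infinite

variable (hm_center : m {center} = 0) (hm_infinite : m univ = ∞)
  (hm : ∫⁻ x, min 1 (radius x) ∂m < ∞)
include hm_center hm_infinite hm

theorem coeffBarDenom_pos_of_infinite (hα : 0 ≤ α) (hγ : 0 ≤ γ) (hβ : ∀ i, 0 ≤ β i) {lam : ℝ}
    (hl : 0 < lam) : 0 < coeffBarDenom α β γ m lam := by
  refine lt_of_lt_of_le ?_ (integral_le_coeffBarDenom hα hγ hβ hl)
  refine (integral_pos_iff_support_of_nonneg
    (fun p => sub_nonneg.2 (minimalLifetime_le_one p))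
    (integrable_one_sub_minimalLifetime hm hl)).2 (pos_iff_ne_zero.2 fun h0 => ?_)
  -- If the integral vanished, `m` would be carried by the center, which is a null set, against
  -- `m(S) = ∞`.
  have hsub : (univ : Set (StarGraph k))
      ⊆ {center} ∪ Function.support fun p => 1 - minimalLifetime lam p := by
    intro p _
    by_cases hp : radius p = 0
    · exact Or.inl (eq_center_of_radius_eq_zero hp)
    · exact Or.inr (sub_pos.2 (minimalLifetime_lt_one hl hp)).ne'
  have := measure_mono_null hsub (measure_union_null hm_center h0)
  rw [hm_infinite] at this
  exact ENNReal.top_ne_zero this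

/-- Off the center `1 - ℓ⁰` increases to `1` as `lam` grows, so by monotone convergence its integral
increases to `m(S) = ∞`. -/
theorem coeffBarDenom_unbounded_of_infinite (hα : 0 ≤ α) (hγ : 0 ≤ γ) (hβ : ∀ i, 0 ≤ β i)
    (C : ℝ) : ∃ lam : ℝ, 0 < lam ∧ C ≤ coeffBarDenom α β γ m lam := by
  have hpos : ∀ n : ℕ, (0 : ℝ) < n + 1 := fun n => by positivity
  have hlim : Tendsto (fun n : ℕ => ∫⁻ p, ENNReal.ofReal (1 - minimalLifetime ((n : ℝ) + 1) p) ∂m)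
      atTop (𝓝 (∫⁻ _, 1 ∂m)) := by
    refine lintegral_tendsto_of_tendsto_of_monotone (fun n => ?_) ?_ ?_
    · exact (continuous_const.sub
        (continuous_minimalLifetime (hpos n))).measurable.ennreal_ofReal.aemeasurable
    · refine .of_forall fun p n n' hn => ENNReal.ofReal_le_ofReal (sub_le_sub_left ?_ 1)
      rw [minimalLifetime, minimalLifetime]
      split_ifs
      · exact le_rfl
      · gcongr
    · have hae : ∀ᵐ p ∂m, p ≠ center := by
        rw [ae_iff]; simpa using hm_center
      filter_upwards [hae] with p hp
      have hp0 : radius p ≠ 0 := fun h => hp (eq_center_of_radius_eq_zero h)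
      have h0 : Tendsto (fun n : ℕ => minimalLifetime ((n : ℝ) + 1) p) atTop (𝓝 0) := by
        simp only [minimalLifetime]
        split_ifs with h
        · exact tendsto_const_nhds
        · have hr := ENNReal.toReal_pos hp0 h
          have h1 : Tendsto (fun n : ℕ => (2 * ((n : ℝ) + 1))) atTop atTop :=
            (tendsto_atTop_add_const_right _ 1 tendsto_natCast_atTop_atTop).const_mul_atTop
              two_pos
          have h2 := (Real.tendsto_sqrt_atTop.comp h1).atTop_mul_const hr
          refine Real.tendsto_exp_atBot.comp ?_
          refine (tendsto_neg_atTop_atBot.comp h2).congr fun n => ?_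
          simp only [Function.comp_apply, neg_mul]
      simpa using ENNReal.tendsto_ofReal (h0.const_sub 1)
  rw [lintegral_one, hm_infinite] at hlim
  obtain ⟨n, hn⟩ := (hlim.eventually (lt_mem_nhds (ENNReal.ofReal_lt_top (r := C)))).exists
  rw [← ofReal_integral_eq_lintegral_ofReal (integrable_one_sub_minimalLifetime hm (hpos n))
    (.of_forall fun p => sub_nonneg.2 (minimalLifetime_le_one p))] at hn
  exact ⟨n + 1, hpos n, (lt_of_not_ge fun h => hn.not_ge (ENNReal.ofReal_le_ofReal h)).le.trans
    (integral_le_coeffBarDenom hα hγ hβ (hpos n))⟩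

end Infinite

/-! ### Approximation by finite measures -/

omit [NeZero k] in
theorem measurableSet_outer (ε : ℝ) : MeasurableSet (outer k ε) :=
  (isClosed_le continuous_const continuous_radius).measurableSet

theorem tendsto_integral_restrict_outer (hm : ∫⁻ x, min 1 (radius x) ∂m < ∞) {lam : ℝ}
    (hl : 0 < lam) (g : C(StarGraph k, ℝ)) :
    Tendsto (fun ε => ∫ p, minimalResolvent lam g p ∂(m.restrict (outer k ε))) (𝓝[>] 0)
      (𝓝 (∫ p, minimalResolvent lam g p ∂m)) := by
  have hint := integrable_minimalResolvent hm hl g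
  simp_rw [← integral_indicator (measurableSet_outer (k := k) _)]
  refine tendsto_integral_filter_of_dominated_convergence (fun p => ‖minimalResolvent lam g p‖)
    (.of_forall fun ε => hint.aestronglyMeasurable.indicator (measurableSet_outer ε))
    (.of_forall fun ε => .of_forall fun p => norm_indicator_le_norm_self _ _) hint.norm
    (.of_forall fun p => ?_)
  -- The indicator is eventually `1` at every point except the center, where `R⁰ g` vanishes.
  by_cases hp : radius p = 0
  · have h0 : minimalResolvent lam g p = 0 := by
      rw [eq_center_of_radius_eq_zero hp, minimalResolvent_center]
    refine (tendsto_congr fun ε => ?_).2 tendsto_const_nhds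
    by_cases hε : p ∈ outer k ε
    · rw [indicator_of_mem hε]
    · rw [indicator_of_notMem hε, h0]
  · refine tendsto_const_nhds.congr' ?_
    have h1 : Tendsto (fun ε : ℝ => ENNReal.ofReal ε) (𝓝[>] 0) (𝓝 0) := by
      have := (ENNReal.continuous_ofReal.tendsto 0)
      rw [ENNReal.ofReal_zero] at this
      exact this.mono_left nhdsWithin_le_nhds
    filter_upwards [h1.eventually (gt_mem_nhds (pos_iff_ne_zero.2 hp))] with ε hε
    rw [indicator_of_mem (show p ∈ outer k ε from hε.le)]

theorem tendsto_coeffBar (hm : ∫⁻ x, min 1 (radius x) ∂m < ∞) {lam : ℝ} (hl : 0 < lam)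
    (hD : coeffBarDenom α β γ m lam ≠ 0) {βε : ℝ → Fin k → ℝ}
    (hβε : ∀ i, Tendsto (fun ε => βε ε i) (𝓝[>] 0) (𝓝 (β i))) (g : C(StarGraph k, ℝ)) :
    Tendsto (fun ε => coeffBar α (βε ε) γ (m.restrict (outer k ε)) lam g) (𝓝[>] 0)
      (𝓝 (coeffBar α β γ m lam g)) := by
  have hc : ∀ g, Tendsto (fun ε => coeff α (βε ε) lam g) (𝓝[>] 0) (𝓝 (coeff α β lam g)) :=
    fun g => ((tendsto_finsetSum _ fun i _ => (hβε i).mul_const _).const_mul _).add_const _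
  exact ((tendsto_integral_restrict_outer hm hl g).add (hc g)).div
    ((((tendsto_integral_restrict_outer hm hl 1).const_mul lam).const_add γ).add
      ((hc 1).const_mul lam)) hD

end StarGraph

end

theorem theorem7p2 (k : ℕ) [NeZero k] (_hk : 2 ≤ k)
    (α γ : ℝ) (hα : 0 ≤ α) (hγ : 0 ≤ γ) (β : Fin k → ℝ) (hβ : ∀ i, 0 ≤ β i)
    (m : Measure (StarGraph k)) (hm_center : m {StarGraph.center} = 0)
    (hm_infty : ∀ i, m {StarGraph.edge i ∞} = 0) (hm_infinite : m univ = ∞)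
    (hm : ∫⁻ x, min 1 (StarGraph.radius x) ∂m < ∞) :
    -- the operator is a Feller generator
    IsFellerGenerator (StarGraph.wentzellLaplacian α β γ m hm) ∧
    -- its resolvent
    (∀ lam : ℝ, 0 < lam →
      (∀ g : C(StarGraph k, ℝ), Integrable (StarGraph.minimalResolvent lam g) m) ∧
      0 < StarGraph.coeffBarDenom α β γ m lam ∧
      ∃ R : C(StarGraph k, ℝ) →L[ℝ] C(StarGraph k, ℝ),
        IsResolventAt (StarGraph.wentzellLaplacian α β γ m hm) lam R ∧
        ∀ g x, R g x = StarGraph.minimalResolvent lam g x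
          + StarGraph.coeffBar α β γ m lam g * StarGraph.minimalLifetime lam x) ∧
    -- convergence of the approximating semigroups
    (∀ βε : ℝ → Fin k → ℝ, (∀ ε, 0 < ε → ∀ i, 0 < βε ε i) →
      (∀ i, Tendsto (fun ε => βε ε i) (𝓝[>] 0) (𝓝 (β i))) →
      (∀ ε, 0 < ε → IsFellerGenerator
        (StarGraph.wentzellLaplacian α (βε ε) γ (m.restrict (StarGraph.outer k ε))
          (StarGraph.lintegral_restrict_outer_lt_top hm ε))) ∧
      ∀ (T : ℝ≥0 → C(StarGraph k, ℝ) →L[ℝ] C(StarGraph k, ℝ))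
        (Tε : ℝ → ℝ≥0 → C(StarGraph k, ℝ) →L[ℝ] C(StarGraph k, ℝ)),
        Generates (StarGraph.wentzellLaplacian α β γ m hm) T →
        (∀ ε, 0 < ε → Generates
          (StarGraph.wentzellLaplacian α (βε ε) γ (m.restrict (StarGraph.outer k ε))
            (StarGraph.lintegral_restrict_outer_lt_top hm ε)) (Tε ε)) →
        ∀ (f : C(StarGraph k, ℝ)) (K : Set ℝ≥0), IsCompact K →
          TendstoUniformlyOn (fun ε t => Tε ε t f) (fun t => T t f) (𝓝[>] 0) K) := by
  have hpos : ∀ lam : ℝ, 0 < lam → 0 < StarGraph.coeffBarDenom α β γ m lam := fun lam hl =>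
    StarGraph.coeffBarDenom_pos_of_infinite hm_center hm_infinite hm hα hγ hβ hl
  have hD := StarGraph.coeffBarDenom_unbounded_of_infinite hm_center hm_infinite hm hα hγ hβ
  obtain ⟨R, HR, hR⟩ := StarGraph.exists_resolvent_wentzellLaplacian hα hγ hβ hm hpos hD
  refine ⟨StarGraph.isFellerGenerator_wentzellLaplacian hα hγ hβ hm hpos hD, fun lam hl =>
    ⟨StarGraph.integrable_minimalResolvent hm hl, hpos lam hl, R lam, HR.isResolventAt hl,
      hR lam hl⟩, fun βε hβε hlim => ⟨fun ε hε => ?_, fun T Tε hT hTε f K hK => ?_⟩⟩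
  · exact StarGraph.isFellerGenerator_wentzellLaplacian hα hγ (fun i => (hβε ε hε i).le)
      (StarGraph.lintegral_restrict_outer_lt_top hm ε)
      (fun lam hl => StarGraph.coeffBarDenom_pos_of_pos hα hγ (hβε ε hε) hl)
      (StarGraph.coeffBarDenom_unbounded_of_pos hα hγ (hβε ε hε))
  have hRε := fun ε (hε : 0 < ε) => StarGraph.exists_resolvent_wentzellLaplacian hα hγ
    (fun i => (hβε ε hε i).le) (StarGraph.lintegral_restrict_outer_lt_top hm ε)
    (fun lam hl => StarGraph.coeffBarDenom_pos_of_pos hα hγ (hβε ε hε) hl)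
    (StarGraph.coeffBarDenom_unbounded_of_pos hα hγ (hβε ε hε))
  -- The values chosen for `ε ≤ 0` are arbitrary and invisible to the filter `𝓝[>] 0`.
  choose! Rε HRε hRε using hRε
  refine tendstoUniformlyOn_semigroup HR (eventually_mem_nhdsWithin.mono HRε)
    hT.generatesContractions
    (eventually_mem_nhdsWithin.mono fun ε hε => (hTε ε hε).generatesContractions)
    (fun g => ?_) f hK
  -- The minimal part `R⁰ g` is the same in all resolvents: `Rε ε 1 g = R 1 g + (C̄_ε(g) - C̄(g))
  -- ℓ⁰`, so norm convergence reduces to that of the scalars.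
  have h1 := ((StarGraph.tendsto_coeffBar (α := α) (γ := γ) hm one_pos (hpos 1 one_pos).ne' hlim
    g).sub_const (StarGraph.coeffBar α β γ m 1 g)).smul_const
    (StarGraph.lifetimeMap one_pos : C(StarGraph k, ℝ))
  rw [sub_self, zero_smul] at h1
  have h2 := h1.const_add (R 1 g)
  rw [add_zero] at h2
  refine h2.congr' ?_
  filter_upwards [self_mem_nhdsWithin] with ε hε
  ext p
  rw [ContinuousMap.add_apply, ContinuousMap.smul_apply, StarGraph.lifetimeMap_apply, hR 1 one_pos,
    hRε ε hε 1 one_pos, smul_eq_mul]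
  ring
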